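/- Let $X$ and $Y$ be compact connected Riemann surfaces, $D\subset X$ a finite subset, $f:Y\to X$ a nonconstant holomorphic map, and $B:=f^{-1}(D)_{\rm red}$. For $y\in Y$ let $m_y\ge 1$ be the multiplicity of $f$ at $y$. Let $E_*$ be a parabolic vector bundle on $X$ with parabolic structure over $D$, i.e. a holomorphic vector bundle $E$ with, for every $x\in D$, a filtration $E_x=E_x^1\supsetneq\cdots\supsetneq E_x^{n_x}\supsetneq E_x^{n_x+1}=0$ and weights $0\le\alpha_x^1<\cdots<\alpha_x^{n_x}<1$. The parabolic pullback $f^*E_*$ is the following parabolic bundle on $Y$ with parabolic structure over $B$. Locally on $X$ write $E_*$ as a direct sum of parabolic line bundles $L_1,\dots,L_r$. Near $y\in B$ the underlying bundle of $f^*E_*$ is $\bigoplus_k f^*L_k\otimes\mathcal O_Y(\lfloor m_y\alpha_k\rfloor y)$, where $\alpha_k$ is the weight of $L_k$ at $f(y)$, and the $k$-th summand has parabolic weight $m_y\alpha_k-\lfloor m_y\alpha_k\rfloor$ at $y$; over $Y\setminus B$ the underlying bundle is $f^*E$; the local pieces are glued by the identity map of $f^*E$. A Higgs field on a parabolic bundle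 $E_*$ over $(X,D)$ is a holomorphic section $\theta$ of $\operatorname{End}(E)\otimes K_X(D)$ whose residue at each $x\in D$ (i.e. its value at $x$, where $K_X(D)_x\cong\mathbb C$ via $dz/z\mapsto 1$) maps $E_x^j$ into $E_x^j$ for all $j$; it is strongly parabolic if the residue maps $E_x^j$ into $E_x^{j+1}$ for all $1\le j\le n_x$ and all $x\in D$. Proposition. Let $\theta$ be a Higgs field on $E_*$. Then there is exactly one Higgs field on the parabolic bundle $f^*E_*$ over $(Y,B)$ whose restriction to $Y\setminus B$ is the Higgs field $(f^*\theta)|_{Y\setminus B}$ on $(f^*E)|_{Y\setminus B}$. If $\theta$ is strongly parabolic, then so is this Higgs field on $f^*E_*$. -/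

import Mathlib

open Bundle Set Filter Topology Module
open scoped Manifold ContDiff Bundle

set_option linter.unusedSectionVars false

noncomputable section

namespace ParHiggs

/-! ### Nonconstant holomorphic maps -/

section Maps

variable (Y X : Type*) [TopologicalSpace Y] [ChartedSpace ℂ Y] [TopologicalSpace X]
  [ChartedSpace ℂ X]

/-- Nonconstant holomorphic maps between Riemann surfaces. -/
structure NonconstHolMap where
  toFun : Y → X
  holomorphic : ContMDiff 𝓘(ℂ) 𝓘(ℂ) ω toFun
  nonconstant : ∃ y y', toFun y ≠ toFun y'

variable {Y X}

instance : CoeFun (NonconstHolMap Y X) (fun _ => Y → X) := ⟨NonconstHolMap.toFun⟩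

/-- The local coordinate centred at `c` given by the preferred chart at `c`. -/
def coord (c p : Y) : ℂ := chartAt ℂ c p - chartAt ℂ c c

/-- The differential at `p` of the local coordinate centred at `c`. -/
def dcoord (c p : Y) : TangentSpace 𝓘(ℂ) p →L[ℂ] ℂ := mfderiv 𝓘(ℂ) 𝓘(ℂ) (coord c) p

/-- The multiplicity of `f` at `y`: the order of vanishing at `y` of a local coordinate centred
at `f y` pulled back by `f`, computed in the local coordinate at `y`. -/
def multiplicity (f : Y → X) (y : Y) : ℕ :=
  analyticOrderNatAt (fun w : ℂ => coord (f y) (f ((chartAt ℂ y).symm w))) (chartAt ℂ y y)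

theorem eventually_eq_or_eventually_ne [IsManifold 𝓘(ℂ) ω Y] [IsManifold 𝓘(ℂ) ω X]
    {f : Y → X} (hf : ContMDiff 𝓘(ℂ) 𝓘(ℂ) ω f) (y : Y) :
    (∀ᶠ y' in 𝓝 y, f y' = f y) ∨ (∀ᶠ y' in 𝓝[≠] y, f y' ≠ f y) := by
  have han : AnalyticAt ℂ (fun w : ℂ => chartAt ℂ (f y) (f ((chartAt ℂ y).symm w)))
      (chartAt ℂ y y) := by
    have h := (contMDiffAt_iff.1 (hf y)).2
    simp only [extChartAt, mfld_simps] at h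
    rw [contDiffWithinAt_univ] at h
    exact h.analyticAt
  have hcont : ContinuousAt (chartAt ℂ y) y :=
    (chartAt ℂ y).continuousAt (mem_chart_source ℂ y)
  have hsrc : ∀ᶠ y' in 𝓝 y, y' ∈ (chartAt ℂ y).source ∧ f y' ∈ (chartAt ℂ (f y)).source :=
    (chart_source_mem_nhds ℂ y |> fun h => Filter.Eventually.and h
      (hf.continuous.continuousAt.eventually (chart_source_mem_nhds ℂ (f y))))
  rcases han.eventually_eq_or_eventually_ne (analyticAt_const (v := chartAt ℂ (f y) (f y)))
    with h | h
  · left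
    filter_upwards [hcont.eventually h, hsrc] with y' h1 h2
    rw [(chartAt ℂ y).left_inv h2.1] at h1
    exact (chartAt ℂ (f y)).injOn h2.2 (mem_chart_source ℂ _) h1
  · right
    have h' : ∀ᶠ w in 𝓝 (chartAt ℂ y y), w ≠ chartAt ℂ y y →
        chartAt ℂ (f y) (f ((chartAt ℂ y).symm w)) ≠ chartAt ℂ (f y) (f y) :=
      eventually_nhdsWithin_iff.1 h
    rw [eventually_nhdsWithin_iff]
    filter_upwards [hcont.eventually h', hsrc] with y' h1 h2 hne heq
    refine h1 (fun hc => hne ((chartAt ℂ y).injOn h2.1 (mem_chart_source ℂ y) hc)) ?_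
    rw [(chartAt ℂ y).left_inv h2.1, heq]

theorem NonconstHolMap.finite_preimage [IsManifold 𝓘(ℂ) ω Y] [IsManifold 𝓘(ℂ) ω X]
    [T1Space X] [CompactSpace Y] [ConnectedSpace Y] (f : NonconstHolMap Y X) {D : Set X}
    (hD : D.Finite) : (f ⁻¹' D).Finite := by
  refine hD.preimage' fun x _ => ?_
  have hcl : IsClosed (f ⁻¹' {x}) := isClosed_singleton.preimage f.holomorphic.continuous
  set S : Set Y := {y | ∀ᶠ y' in 𝓝 y, f y' = x} with hS
  have hSsub : S ⊆ f ⁻¹' {x} := fun y hy => hy.self_of_nhds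
  have hSo : IsOpen S := isOpen_setOfPred_eventually_nhds
  have hSc : IsClosed S := by
    refine isClosed_of_closure_subset fun y hy => ?_
    have hfy : f y = x := hcl.closure_subset_iff.2 hSsub hy
    rcases eventually_eq_or_eventually_ne f.holomorphic y with h | h
    · have h' : ∀ᶠ y' in 𝓝 y, f y' = x := by simpa only [hfy] using h
      exact h'
    · by_contra hyS
      rw [eventually_nhdsWithin_iff] at h
      obtain ⟨y', hy', hy'S⟩ := (mem_closure_iff_frequently.1 hy).and_eventually h |>.exists
      refine hy'S (fun hh => hyS (hh ▸ hy')) ?_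
      rw [hfy]
      exact hSsub hy'
  rcases isClopen_iff.1 ⟨hSc, hSo⟩ with h | h
  · refine hcl.isCompact.finite ?_
    rw [isDiscrete_iff_nhdsNE]
    intro y hy
    rcases eventually_eq_or_eventually_ne f.holomorphic y with h1 | h1
    · have : y ∈ S := by
        have hy' : f y = x := hy
        have h1' : ∀ᶠ y' in 𝓝 y, f y' = x := by simpa only [hy'] using h1
        exact h1'
      simp [h] at this
    · rw [disjoint_iff.symm.trans (Filter.disjoint_principal_right (s := f ⁻¹' {x}))]
      filter_upwards [h1] with z hz hzx
      exact hz (hzx.trans (Eq.symm hy))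
  · obtain ⟨a, b, hab⟩ := f.nonconstant
    exact absurd ((hSsub (h ▸ mem_univ a)).trans (hSsub (h ▸ mem_univ b)).symm) hab

end Maps

/-! ### Parabolic bundles -/

section Parabolic

variable {X : Type*} [TopologicalSpace X] [ChartedSpace ℂ X]
  {E : X → Type*} [∀ x, AddCommGroup (E x)] [∀ x, Module ℂ (E x)]

/-- A parabolic structure on `E` over the finite set `D`. The `length x` proper steps of the flag
at `x` are indexed from `0`: `flag x j` is the subspace usually written `E^{j+1}_x`, and
`weight x j` is its weight. -/
structure ParabolicStructure (E : X → Type*) [∀ x, AddCommGroup (E x)] [∀ x, Module ℂ (E x)]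
    (D : Set X) where
  finite_divisor : D.Finite
  length : D → ℕ
  flag : ∀ x : D, Fin (length x + 1) → Submodule ℂ (E x)
  flag_zero : ∀ x, flag x 0 = ⊤
  flag_last : ∀ x, flag x (Fin.last _) = ⊥
  flag_strictAnti : ∀ x, StrictAnti (flag x)
  weight : ∀ x : D, Fin (length x) → ℝ
  weight_strictMono : ∀ x, StrictMono (weight x)
  weight_nonneg : ∀ x j, 0 ≤ weight x j
  weight_lt_one : ∀ x j, weight x j < 1

variable (F : Type*) [NormedAddCommGroup F] [NormedSpace ℂ F]
  [TopologicalSpace (TotalSpace F E)] [∀ x, TopologicalSpace (E x)] [FiberBundle F E]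

/-- Local decompositions of a parabolic bundle into parabolic line bundles: around every point `x`
a holomorphic frame `frame x 0, …, frame x (r - 1)` on an open neighbourhood `nbhd x`, such that
for `x ∈ D` the parabolic bundle is, near `x`, the direct sum of the line bundles spanned by the
members of the frame, the `k`-th one with parabolic weight `weight x (pos x k)` at `x`. -/
structure ParabolicStructure.Splitting {D : Set X} (P : ParabolicStructure E D) where
  nbhd : X → Set X
  isOpen_nbhd : ∀ x, IsOpen (nbhd x)
  mem_nbhd : ∀ x, x ∈ nbhd x
  frame : ∀ _ : X, Fin (finrank ℂ F) → ∀ x', E x'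
  isLocalFrameOn : ∀ x, IsLocalFrameOn 𝓘(ℂ) F ω (frame x) (nbhd x)
  pos : ∀ x : D, Fin (finrank ℂ F) → Fin (P.length x)
  flag_eq : ∀ (x : D) (i), P.flag x i =
    Submodule.span ℂ {v | ∃ k, i ≤ (pos x k).castSucc ∧ v = frame x k x}

/-- The linear algebra behind `Splitting`: a flag has an adapted basis. -/
theorem exists_adapted_basis {V : Type*} [AddCommGroup V] [Module ℂ V] [FiniteDimensional ℂ V]
    {n : ℕ} (fl : Fin (n + 1) → Submodule ℂ V) (h0 : fl 0 = ⊤) (hl : fl (Fin.last n) = ⊥)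
    (hanti : Antitone fl) :
    ∃ (b : Basis (Fin (finrank ℂ V)) ℂ V) (pos : Fin (finrank ℂ V) → Fin n),
      ∀ i, fl i = Submodule.span ℂ {v | ∃ k, i ≤ (pos k).castSucc ∧ v = b k} := by
  have key : ∀ i : Fin (n + 1), ∃ (S : Set V) (p : V → ℕ), LinearIndepOn ℂ id S ∧
      (∀ v ∈ S, p v < n) ∧ (∀ v ∈ S, (i : ℕ) ≤ p v) ∧
      ∀ j, i ≤ j → fl j = Submodule.span ℂ {v | v ∈ S ∧ (j : ℕ) ≤ p v} := by
    intro i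
    induction i using Fin.reverseInduction with
    | last =>
      refine ⟨∅, fun _ => 0, linearIndepOn_empty _ _, by simp, by simp, fun j hj => ?_⟩
      rw [Fin.last_le_iff.1 hj, hl]
      simp
    | cast i ih =>
      obtain ⟨S, p, hS, hp, hpi, hspan⟩ := ih
      have hSsub : S ⊆ (fl i.castSucc : Set V) := by
        intro v hv
        have : v ∈ fl i.succ := by
          rw [hspan i.succ le_rfl]
          exact Submodule.subset_span ⟨hv, hpi v hv⟩
        exact hanti (Fin.castSucc_lt_succ).le this
      obtain ⟨T, hT, hST, hTspan, hTli⟩ := exists_linearIndepOn_extension hS hSsub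
      classical
      refine ⟨T, fun v => if v ∈ S then p v else i, hTli, ?_, ?_, ?_⟩
      · intro v _
        dsimp only
        split_ifs with h
        · exact hp v h
        · exact i.2
      · intro v _
        dsimp only
        split_ifs with h
        · have := hpi v h
          simp at this ⊢
          omega
        · simp
      · intro j hj
        rcases hj.eq_or_lt with rfl | hj
        · have : {v | v ∈ T ∧ ((i.castSucc : Fin (n + 1)) : ℕ) ≤ if v ∈ S then p v else i} = T := by
            ext v
            simp only [mem_ofPred_eq, and_iff_left_iff_imp]
            intro _
            split_ifs with h
            · have := hpi v h
              simp at this ⊢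
              omega
            · simp
          rw [this]
          exact le_antisymm (by simpa using hTspan) (Submodule.span_le.2 hT)
        · rw [hspan j (Fin.castSucc_lt_iff_succ_le.1 hj)]
          congr 1
          ext v
          simp only [mem_ofPred_eq]
          have hij : (i : ℕ) < j := hj
          constructor
          · rintro ⟨h1, h2⟩
            exact ⟨hST h1, by simp [h1, h2]⟩
          · rintro ⟨h1, h2⟩
            split_ifs at h2 with h
            · exact ⟨h, h2⟩
            · omega
  obtain ⟨S, p, hS, hp, -, hspan⟩ := key 0
  have htop : ⊤ ≤ Submodule.span ℂ (range (Subtype.val : S → V)) := by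
    rw [← h0, hspan 0 le_rfl]
    simp
  let b := Basis.mk (v := (Subtype.val : S → V)) hS htop
  have hb : ∀ s, b s = s := fun s => Basis.mk_apply _ _ s
  have : Finite S := Module.Finite.finite_basis b
  let : Fintype S := Fintype.ofFinite S
  have hc : Fintype.card S = finrank ℂ V := (finrank_eq_card_basis b).symm
  let e : S ≃ Fin (finrank ℂ V) := Fintype.equivFinOfCardEq hc
  refine ⟨b.reindex e, fun k => ⟨p (e.symm k), hp _ (e.symm k).2⟩, fun i => ?_⟩
  rw [hspan i (Fin.zero_le i)]
  congr 1
  ext v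
  constructor
  · rintro ⟨h1, h2⟩
    exact ⟨e ⟨v, h1⟩, by simpa [Fin.le_def] using h2, by simp [hb]⟩
  · rintro ⟨k, h1, rfl⟩
    exact ⟨by simp [hb], by simpa [Fin.le_def, hb] using h1⟩

/-- Every parabolic bundle is locally a direct sum of parabolic line bundles. -/
theorem ParabolicStructure.nonempty_splitting [FiniteDimensional ℂ F] [VectorBundle ℂ F E]
    [ContMDiffVectorBundle ω F E 𝓘(ℂ)] {D : Set X} (P : ParabolicStructure E D) :
    Nonempty (P.Splitting F) := by
  classical
  have key : ∀ x : X, ∃ (b : Basis (Fin (finrank ℂ F)) ℂ F),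
      ∀ hx : x ∈ D, ∃ pos : Fin (finrank ℂ F) → Fin (P.length ⟨x, hx⟩), ∀ i,
        P.flag ⟨x, hx⟩ i = Submodule.span ℂ {v | ∃ k, i ≤ (pos k).castSucc ∧
          v = (trivializationAt F E x).localFrame b k x} := by
    intro x
    by_cases hx : x ∈ D
    · have hmem : x ∈ (trivializationAt F E x).baseSet :=
        FiberBundle.mem_baseSet_trivializationAt' x
      let φ := (trivializationAt F E x).linearEquivAt ℂ x hmem
      have : FiniteDimensional ℂ (E x) := Module.Finite.equiv φ.symm
      obtain ⟨b, pos, h⟩ := exists_adapted_basis (P.flag ⟨x, hx⟩) (P.flag_zero _)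
        (P.flag_last _) (P.flag_strictAnti _).antitone
      have hr : finrank ℂ (E x) = finrank ℂ F := φ.finrank_eq
      refine ⟨(b.reindex (finCongr hr)).map φ, fun _ => ⟨fun k => pos (finCongr hr.symm k),
        fun i => ?_⟩⟩
      rw [h i]
      congr 1
      ext v
      have hv : ∀ k, (trivializationAt F E x).localFrame
          ((b.reindex (finCongr hr)).map φ) k x = b (finCongr hr.symm k) := by
        intro k
        rw [Trivialization.localFrame_apply_of_mem_baseSet _ _ hmem]
        simp only [Trivialization.basisAt, Basis.map_apply, LinearEquiv.symm_apply_apply, φ,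
          Basis.reindex_apply, finCongr_symm]
      simp only [mem_ofPred_eq, hv]
      constructor
      · rintro ⟨k, h1, h2⟩
        exact ⟨finCongr hr k, by simpa using h1, by simpa using h2⟩
      · rintro ⟨k, h1, h2⟩
        exact ⟨_, h1, h2⟩
    · exact ⟨finBasis ℂ F, fun h => absurd h hx⟩
  choose b hb using key
  choose pos hpos using hb
  exact ⟨{
    nbhd := fun x => (trivializationAt F E x).baseSet
    isOpen_nbhd := fun x => (trivializationAt F E x).open_baseSet
    mem_nbhd := fun x => FiberBundle.mem_baseSet_trivializationAt' x
    frame := fun x => (trivializationAt F E x).localFrame (b x)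
    isLocalFrameOn := fun x => Trivialization.isLocalFrameOn_localFrame_baseSet _ _ _ _
    pos := fun x => pos x x.2
    flag_eq := fun x => hpos x x.2 }⟩

end Parabolic

/-! ### Higgs fields -/

section Higgs

variable {X : Type*} [TopologicalSpace X] [ChartedSpace ℂ X]
  (F : Type*) [NormedAddCommGroup F] [NormedSpace ℂ F]
  (E : X → Type*) [∀ x, AddCommGroup (E x)] [∀ x, Module ℂ (E x)]
  [TopologicalSpace (TotalSpace F E)] [∀ x, TopologicalSpace (E x)] [FiberBundle F E]
  [VectorBundle ℂ F E] [∀ x, IsTopologicalAddGroup (E x)] [∀ x, ContinuousSMul ℂ (E x)]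

/-- Global holomorphic sections of `End(E) ⊗ K_X(D)`, for a finite set `D`. The fibre of `K_X(D)`
at `x` is the cotangent space if `x ∉ D`, and is identified with `ℂ` if `x ∈ D`, the generator
`1` being the value at `x` of `dz / z` for any holomorphic coordinate `z` centred at `x`. So a
section consists of an `End(E)`-valued cotangent vector at each point outside `D` and of an
endomorphism, the residue, at each point of `D`; it is holomorphic if it is locally `B dz`
(near points outside `D`) or `B dz / z` (near points of `D`) with `B` a holomorphic section of
`End(E)`. -/
@[ext]
structure LogHiggsField (D : Set X) where
  form : ∀ x : (Dᶜ : Set X), TangentSpace 𝓘(ℂ) (x : X) →L[ℂ] (E x →L[ℂ] E x)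
  res : ∀ x : D, E x →L[ℂ] E x
  holomorphic_off : ∀ x₀ : (Dᶜ : Set X), ∃ B : ∀ x : X, E x →L[ℂ] E x,
    ContMDiffAt 𝓘(ℂ) (𝓘(ℂ).prod 𝓘(ℂ, F →L[ℂ] F)) ω
      (fun x => TotalSpace.mk' (F →L[ℂ] F) (E := fun x => E x →L[ℂ] E x) x (B x)) (x₀ : X) ∧
    ∀ᶠ x in 𝓝 (x₀ : X), ∀ (hx : x ∈ Dᶜ) (v : TangentSpace 𝓘(ℂ) x),
      form ⟨x, hx⟩ v = dcoord (x₀ : X) x v • B x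
  holomorphic_at : ∀ x₀ : D, ∃ B : ∀ x : X, E x →L[ℂ] E x,
    ContMDiffAt 𝓘(ℂ) (𝓘(ℂ).prod 𝓘(ℂ, F →L[ℂ] F)) ω
      (fun x => TotalSpace.mk' (F →L[ℂ] F) (E := fun x => E x →L[ℂ] E x) x (B x)) (x₀ : X) ∧
    B x₀ = res x₀ ∧
    ∀ᶠ x in 𝓝 (x₀ : X), ∀ (hx : x ∈ Dᶜ) (v : TangentSpace 𝓘(ℂ) x),
      form ⟨x, hx⟩ v = (dcoord (x₀ : X) x v / coord (x₀ : X) x) • B x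

variable {E} {D : Set X}

/-- Higgs fields on a parabolic bundle: sections of `End_P(E_*) ⊗ K_X(D)`, that is, sections of
`End(E) ⊗ K_X(D)` whose value at every point of `D` preserves the flag. -/
@[ext]
structure HiggsField (P : ParabolicStructure E D) extends LogHiggsField F E D where
  preserves : ∀ (x : D) (j : Fin (P.length x + 1)), ∀ v ∈ P.flag x j, res x v ∈ P.flag x j

/-- Strongly parabolic Higgs fields: sections of `End_n(E_*) ⊗ K_X(D)`. -/
def HiggsField.IsStrong {F} [NormedAddCommGroup F] [NormedSpace ℂ F]
    [TopologicalSpace (TotalSpace F E)] [FiberBundle F E] [VectorBundle ℂ F E]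
    {P : ParabolicStructure E D} (θ : HiggsField F P) : Prop :=
  ∀ (x : D) (j : Fin (P.length x)), ∀ v ∈ P.flag x j.castSucc, θ.res x v ∈ P.flag x j.succ

end Higgs

/-! ### Pullback of parabolic bundles -/

section Pullback

section Frame

variable {X : Type*} [TopologicalSpace X] [ChartedSpace ℂ X]
  {E : X → Type*} [∀ x, AddCommGroup (E x)] [∀ x, Module ℂ (E x)]
  {F : Type*} [NormedAddCommGroup F] [NormedSpace ℂ F]
  [TopologicalSpace (TotalSpace F E)] [∀ x, TopologicalSpace (E x)] [FiberBundle F E]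
  [VectorBundle ℂ F E] [FiniteDimensional ℂ F]

/-- The coefficients of a holomorphic section in a holomorphic frame are holomorphic. -/
theorem contMDiffAt_coeff {r : ℕ} {s : Fin r → ∀ x, E x} {U : Set X}
    (hs : IsLocalFrameOn 𝓘(ℂ) F ω s U) (hU : IsOpen U) {x : X} (hx : x ∈ U) {t : ∀ x, E x}
    (ht : ContMDiffAt 𝓘(ℂ) (𝓘(ℂ).prod 𝓘(ℂ, F)) ω (fun x => TotalSpace.mk' F x (t x)) x)
    (k : Fin r) : ContMDiffAt 𝓘(ℂ) 𝓘(ℂ) ω (fun x' => hs.coeff k x' (t x')) x := by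
  let e := trivializationAt F E x
  have hxe : x ∈ e.baseSet := FiberBundle.mem_baseSet_trivializationAt' x
  have hsec : ∀ {u : ∀ x, E x},
      ContMDiffAt 𝓘(ℂ) (𝓘(ℂ).prod 𝓘(ℂ, F)) ω (fun x => TotalSpace.mk' F x (u x)) x →
      ContMDiffAt 𝓘(ℂ) 𝓘(ℂ, F) ω (fun x' => (e ⟨x', u x'⟩).2) x := fun hu =>
    (contMDiffAt_section x).1 hu
  let col : Fin r → (F →L[ℂ] ((Fin r → ℂ) →L[ℂ] F)) := fun k =>
    ContinuousLinearMap.smulRightL ℂ (Fin r → ℂ) F (ContinuousLinearMap.proj k)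
  let L : X → ((Fin r → ℂ) →L[ℂ] F) := fun x' => ∑ k, col k (e ⟨x', s k x'⟩).2
  have hL : ContMDiffAt 𝓘(ℂ) 𝓘(ℂ, (Fin r → ℂ) →L[ℂ] F) ω L x := by
    refine ContMDiffAt.sum fun k _ => ?_
    exact (col k).contMDiff.contMDiffAt.comp x (hsec (hs.contMDiffAt hU hx k))
  have hLeq : ∀ x' (h1 : x' ∈ U) (_ : x' ∈ e.baseSet), ∃ A : (Fin r → ℂ) ≃L[ℂ] F,
      (A : (Fin r → ℂ) →L[ℂ] F) = L x' ∧
      ∀ v : E x', A.symm (e ⟨x', v⟩).2 = (hs.toBasisAt h1).equivFun v := by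
    intro x' h1 h2
    let A := ((hs.toBasisAt h1).equivFun.symm.trans
      (e.linearEquivAt ℂ x' h2)).toContinuousLinearEquiv
    refine ⟨A, ?_, fun v => ?_⟩
    · ext k
      simp [A, L, col, Basis.equivFun_symm_apply]
    · rw [ContinuousLinearEquiv.symm_apply_eq]
      change _ = e.linearEquivAt ℂ x' h2 ((hs.toBasisAt h1).equivFun.symm
        ((hs.toBasisAt h1).equivFun v))
      rw [LinearEquiv.symm_apply_apply]
      rfl
  have hev : ∀ᶠ x' in 𝓝 x, x' ∈ U ∩ e.baseSet :=
    (hU.inter e.open_baseSet).mem_nhds ⟨hx, hxe⟩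
  have hinv : ContMDiffAt 𝓘(ℂ) 𝓘(ℂ, F →L[ℂ] (Fin r → ℂ)) ω
      (fun x' => ContinuousLinearMap.inverse (L x')) x := by
    obtain ⟨A, hA, -⟩ := hLeq x hx hxe
    have h : ContDiffAt ℂ ω (ContinuousLinearMap.inverse (M := Fin r → ℂ) (M₂ := F)) (L x) :=
      hA ▸ contDiffAt_map_inverse A
    exact h.contMDiffAt.comp x hL
  have happ : ContMDiffAt 𝓘(ℂ) 𝓘(ℂ, Fin r → ℂ) ω
      (fun x' => ContinuousLinearMap.inverse (L x') (e ⟨x', t x'⟩).2) x :=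
    hinv.clm_apply (hsec ht)
  refine (contMDiffAt_pi_space.1 happ k).congr_of_eventuallyEq ?_
  filter_upwards [hev] with x' hx'
  obtain ⟨A, hA, hA'⟩ := hLeq x' hx'.1 hx'.2
  rw [← hA, ContinuousLinearMap.inverse_equiv]
  have := congrFun (hA' (t x')) k
  simp only [ContinuousLinearEquiv.coe_coe, this]
  rw [hs.coeff_apply_of_mem hx'.1]
  rfl

end Frame

variable {X Y : Type*} [TopologicalSpace X] [ChartedSpace ℂ X] [IsManifold 𝓘(ℂ) ω X] [T2Space X]
  [TopologicalSpace Y] [ChartedSpace ℂ Y] [IsManifold 𝓘(ℂ) ω Y] [T2Space Y] [CompactSpace Y]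
  [ConnectedSpace Y]
  {F : Type*} [NormedAddCommGroup F] [NormedSpace ℂ F] [FiniteDimensional ℂ F]
  {E : X → Type*} [∀ x, AddCommGroup (E x)] [∀ x, Module ℂ (E x)]
  [TopologicalSpace (TotalSpace F E)] [∀ x, TopologicalSpace (E x)] [FiberBundle F E]
  [VectorBundle ℂ F E]
  {D : Set X} {P : ParabolicStructure E D} (S : P.Splitting F) (f : NonconstHolMap Y X)

/-- `m_y α_k`, where `y ∈ f⁻¹(D)`, `m_y` is the multiplicity of `f` at `y` and `α_k` is the
parabolic weight at `f y` of the `k`-th line bundle of the splitting around `f y`. -/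
def scaledWeight (y : (f ⁻¹' D : Set Y)) (k : Fin (finrank ℂ F)) : ℝ :=
  multiplicity f (y : Y) * P.weight ⟨f y, y.2⟩ (S.pos ⟨f y, y.2⟩ k)

open Classical in
/-- The twist at `c ∈ Y` of the pullback of the `k`-th line bundle: it is `⌊m_c α_k⌋` if
`f c ∈ D`, and there is no twist if `f c ∉ D`. -/
def twist (c : Y) (k : Fin (finrank ℂ F)) : ℕ :=
  if h : c ∈ f ⁻¹' D then ⌊scaledWeight S f ⟨c, h⟩ k⌋₊ else 0

/-- The domain of the `c`-th trivialization of the pullback. -/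
def pullbackBaseSet (c : Y) : Set Y :=
  (chartAt ℂ c).source ∩ f ⁻¹' (S.nbhd (f c)) ∩ (f ⁻¹' D \ {c})ᶜ

/-- The `c`-th trivialization corresponds to the frame
`coord c ^ (- twist c k) • f^*(frame (f c) k)` outside `f⁻¹(D)`. This is the change of frames from
the `c`-th to the `c'`-th of them at `p ∉ f⁻¹(D)`. -/
def transition (c c' p : Y) (k l : Fin (finrank ℂ F)) : ℂ :=
  coord c' p ^ twist S f c' k *
    (S.isLocalFrameOn (f c')).coeff k (f p) (S.frame (f c) l (f p)) *
    (coord c p ^ twist S f c l)⁻¹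

/-- Square matrices as continuous linear maps. -/
def matCLM (r : ℕ) : (Fin r → Fin r → ℂ) →L[ℂ] ((Fin r → ℂ) →L[ℂ] (Fin r → ℂ)) :=
  LinearMap.toContinuousLinearMap
    ((LinearMap.toContinuousLinearMap : ((Fin r → ℂ) →ₗ[ℂ] (Fin r → ℂ)) ≃ₗ[ℂ] _).toLinearMap ∘ₗ
      (Matrix.toLin' : Matrix (Fin r) (Fin r) ℂ ≃ₗ[ℂ] _).toLinearMap)

theorem matCLM_apply {r : ℕ} (M : Fin r → Fin r → ℂ) (v : Fin r → ℂ) (k : Fin r) :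
    matCLM r M v k = ∑ l, M k l * v l := rfl

open Classical in
/-- The changes of coordinates of the pullback. Two different ones of its trivializations meet
outside `f⁻¹(D)` only. -/
def pullbackCoordChange (c c' p : Y) :
    (Fin (finrank ℂ F) → ℂ) →L[ℂ] (Fin (finrank ℂ F) → ℂ) :=
  if p ∈ f ⁻¹' D then ContinuousLinearMap.id ℂ _ else matCLM _ (transition S f c c' p)

variable {S f}

theorem eq_of_mem_pullbackBaseSet {c p : Y} (hp : p ∈ pullbackBaseSet S f c)
    (h : p ∈ f ⁻¹' D) : p = c := by
  by_contra hne
  exact hp.2 ⟨h, hne⟩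

theorem coord_pow_twist_ne_zero {c p : Y} (hp : p ∈ pullbackBaseSet S f c) (h : p ∉ f ⁻¹' D)
    (k : Fin (finrank ℂ F)) : coord c p ^ twist S f c k ≠ 0 := by
  by_cases hc : c ∈ f ⁻¹' D
  · refine pow_ne_zero _ fun h0 => h ?_
    have : p = c := (chartAt ℂ c).injOn hp.1.1 (mem_chart_source ℂ c) (sub_eq_zero.1 h0)
    exact this ▸ hc
  · simp [twist, hc]

theorem sum_coeff_frame {c p : Y} (hp : p ∈ pullbackBaseSet S f c) (v : E (f p)) :
    ∑ l, (S.isLocalFrameOn (f c)).coeff l (f p) v • S.frame (f c) l (f p) = v := by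
  classical
  let t : ∀ x, E x := fun x => if h : x = f p then h ▸ v else 0
  have ht : t (f p) = v := by simp [t]
  have := (S.isLocalFrameOn (f c)).coeff_sum_eq t hp.1.2
  rw [ht] at this
  exact this.symm

theorem coeff_frame {c p : Y} (hp : p ∈ pullbackBaseSet S f c) (k l : Fin (finrank ℂ F)) :
    (S.isLocalFrameOn (f c)).coeff k (f p) (S.frame (f c) l (f p)) = if l = k then 1 else 0 := by
  rw [(S.isLocalFrameOn (f c)).coeff_apply_of_mem hp.1.2,
    ← (S.isLocalFrameOn (f c)).toBasisAt_coe hp.1.2 l, Basis.repr_self, Finsupp.single_apply]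

theorem pullbackCoordChange_self {c p : Y} (hp : p ∈ pullbackBaseSet S f c) :
    pullbackCoordChange S f c c p = ContinuousLinearMap.id ℂ _ := by
  unfold pullbackCoordChange
  split_ifs with h
  · rfl
  · refine ContinuousLinearMap.ext fun v => funext fun k => ?_
    have h1 : ∀ l, transition S f c c p k l = if k = l then 1 else 0 := by
      intro l
      rw [transition, coeff_frame hp]
      rcases eq_or_ne l k with rfl | hl
      · simp [coord_pow_twist_ne_zero hp h]
      · simp [hl, hl.symm]
    simp [matCLM_apply, h1]

theorem pullbackCoordChange_comp {c c' c'' p : Y} (hp' : p ∈ pullbackBaseSet S f c')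
    (v : Fin (finrank ℂ F) → ℂ) :
    pullbackCoordChange S f c' c'' p (pullbackCoordChange S f c c' p v) =
      pullbackCoordChange S f c c'' p v := by
  unfold pullbackCoordChange
  split_ifs with h
  · rfl
  · funext k
    simp only [matCLM_apply, Finset.mul_sum]
    rw [Finset.sum_comm]
    refine Finset.sum_congr rfl fun j _ => ?_
    have key := congrArg ((S.isLocalFrameOn (f c'')).coeff k (f p))
      (sum_coeff_frame hp' (S.frame (f c) j (f p)))
    rw [map_sum] at key
    simp only [transition, ← key, Finset.sum_mul, Finset.mul_sum, map_smul, smul_eq_mul]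
    refine Finset.sum_congr rfl fun l _ => ?_
    have := coord_pow_twist_ne_zero hp' h l
    field_simp

theorem isOpen_pullbackBaseSet (c : Y) : IsOpen (pullbackBaseSet S f c) :=
  ((chartAt ℂ c).open_source.inter ((S.isOpen_nbhd _).preimage f.holomorphic.continuous)).inter
    ((f.finite_preimage P.finite_divisor).subset sdiff_subset).isClosed.isOpen_compl

theorem contMDiffAt_coord {c p : Y} (hp : p ∈ (chartAt ℂ c).source) :
    ContMDiffAt 𝓘(ℂ) 𝓘(ℂ) ω (coord c) p :=
  ((contMDiffOn_chart (I := 𝓘(ℂ)) (n := ω) (x := c)).contMDiffAt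
    ((chartAt ℂ c).open_source.mem_nhds hp)).sub contMDiffAt_const

theorem contMDiffOn_pullbackCoordChange (c c' : Y) :
    ContMDiffOn 𝓘(ℂ) 𝓘(ℂ, (Fin (finrank ℂ F) → ℂ) →L[ℂ] (Fin (finrank ℂ F) → ℂ)) ω
      (pullbackCoordChange S f c c') (pullbackBaseSet S f c ∩ pullbackBaseSet S f c') := by
  rintro p ⟨hp, hp'⟩
  refine ContMDiffAt.contMDiffWithinAt ?_
  by_cases hcc : c = c'
  · subst hcc
    refine (contMDiffAt_const (c := ContinuousLinearMap.id ℂ _)).congr_of_eventuallyEq ?_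
    filter_upwards [(isOpen_pullbackBaseSet c).mem_nhds hp] with q hq
    exact pullbackCoordChange_self hq
  · have hD : p ∉ f ⁻¹' D := fun h =>
      hcc ((eq_of_mem_pullbackBaseSet hp h).symm.trans (eq_of_mem_pullbackBaseSet hp' h))
    have hf : ContMDiffAt 𝓘(ℂ) 𝓘(ℂ) ω f p := f.holomorphic p
    have hM : ContMDiffAt 𝓘(ℂ) 𝓘(ℂ, Fin (finrank ℂ F) → Fin (finrank ℂ F) → ℂ) ω
        (transition S f c c') p := by
      refine contMDiffAt_pi_space.2 fun k => contMDiffAt_pi_space.2 fun l => ?_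
      have h1 : ContMDiffAt 𝓘(ℂ) 𝓘(ℂ) ω (fun p => coord c' p ^ twist S f c' k) p :=
        (contMDiffAt_coord hp'.1.1).pow _
      have h2 : ContMDiffAt 𝓘(ℂ) 𝓘(ℂ) ω (fun p => (coord c p ^ twist S f c l)⁻¹) p :=
        ((contMDiffAt_coord hp.1.1).pow _).inv₀ (coord_pow_twist_ne_zero hp hD l)
      have h3 : ContMDiffAt 𝓘(ℂ) 𝓘(ℂ) ω (fun p =>
          (S.isLocalFrameOn (f c')).coeff k (f p) (S.frame (f c) l (f p))) p :=
        (contMDiffAt_coeff (S.isLocalFrameOn (f c')) (S.isOpen_nbhd _) hp'.1.2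
          ((S.isLocalFrameOn (f c)).contMDiffAt (S.isOpen_nbhd _) hp.1.2 l) k).comp p hf
      exact (h1.mul h3).mul h2
    refine ((matCLM _).contMDiff.contMDiffAt.comp p hM).congr_of_eventuallyEq ?_
    have hopen : IsOpen (f ⁻¹' D)ᶜ :=
      (f.finite_preimage P.finite_divisor).isClosed.isOpen_compl
    filter_upwards [hopen.mem_nhds hD] with q hq
    exact if_neg hq

variable (S f)

/-- The holomorphic vector bundle underlying `f^*E_*`, built by gluing: around `c ∈ Y` it is the
direct sum over `k` of the line bundles `f^*L_k ⊗ O(⌊m_c α_k⌋ c)`, where `L_k` are the line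
bundles of the splitting around `f c`; these are glued by the identity of `f^*E`. -/
def pullbackCore : VectorBundleCore ℂ Y (Fin (finrank ℂ F) → ℂ) Y where
  baseSet := pullbackBaseSet S f
  isOpen_baseSet := isOpen_pullbackBaseSet
  indexAt := id
  mem_baseSet_at c := ⟨⟨mem_chart_source ℂ c, S.mem_nbhd _⟩, fun h => h.2 rfl⟩
  coordChange := pullbackCoordChange S f
  coordChange_self c p hp v := by rw [pullbackCoordChange_self hp]; rfl
  continuousOn_coordChange c c' := (contMDiffOn_pullbackCoordChange c c').continuousOn
  coordChange_comp _ _ _ _ hp v := pullbackCoordChange_comp hp.1.2 v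

instance : (pullbackCore S f).IsContMDiff 𝓘(ℂ) ω := ⟨contMDiffOn_pullbackCoordChange⟩

/-- The fibres of the vector bundle underlying `f^*E_*`. -/
abbrev PullbackFiber : Y → Type := (pullbackCore S f).Fiber

instance (y : Y) : IsTopologicalAddGroup (PullbackFiber S f y) :=
  inferInstanceAs (IsTopologicalAddGroup (Fin (finrank ℂ F) → ℂ))

instance (y : Y) : ContinuousSMul ℂ (PullbackFiber S f y) :=
  inferInstanceAs (ContinuousSMul ℂ (Fin (finrank ℂ F) → ℂ))

/-- The canonical identification of `f^*E` with the bundle underlying `f^*E_*` over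
`Y ∖ f⁻¹(D)`. -/
def pullbackIso (y : ((f ⁻¹' D)ᶜ : Set Y)) : E (f y) ≃ₗ[ℂ] PullbackFiber S f y :=
  ((S.isLocalFrameOn (f y)).toBasisAt (S.mem_nbhd (f y))).equivFun

/-- In the `c`-th trivialization, the canonical identification sends
`∑ a_k f^*(frame (f c) k)` to `(coord c ^ (twist c k) * a_k)_k`. -/
theorem localTriv_pullbackIso (c : Y) (p : ((f ⁻¹' D)ᶜ : Set Y))
    (v : E (f p)) (k : Fin (finrank ℂ F)) :
    ((pullbackCore S f).localTriv c ⟨p, pullbackIso S f p v⟩).2 k =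
      coord c p ^ twist S f c k * (S.isLocalFrameOn (f c)).coeff k (f p) v := by
  have hpp : (p : Y) ∈ pullbackBaseSet S f p :=
    ⟨⟨mem_chart_source ℂ _, S.mem_nbhd _⟩, fun h => h.2 rfl⟩
  have hv : ∀ l, (pullbackIso S f p v : Fin (finrank ℂ F) → ℂ) l =
      (S.isLocalFrameOn (f p)).coeff l (f p) v := by
    intro l
    simp only [IsLocalFrameOn.coeff, dif_pos (S.mem_nbhd (f p))]
    rfl
  have ht : ∀ l, twist S f p l = 0 := fun l => dif_neg p.2
  have hw : ∀ w : Fin (finrank ℂ F) → ℂ,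
      (∀ l, w l = (S.isLocalFrameOn (f p)).coeff l (f p) v) →
      pullbackCoordChange S f p c p w k =
        coord c p ^ twist S f c k * (S.isLocalFrameOn (f c)).coeff k (f p) v := by
    intro w hw
    rw [pullbackCoordChange, if_neg p.2, matCLM_apply]
    simp only [transition, ht, pow_zero, inv_one, mul_one, mul_assoc, ← Finset.mul_sum]
    congr 1
    conv_rhs => rw [← sum_coeff_frame hpp v, map_sum]
    refine Finset.sum_congr rfl fun l _ => ?_
    rw [map_smul, smul_eq_mul, mul_comm, hw]
  exact hw _ hv

/-- The parabolic weights `m_y α_k - ⌊m_y α_k⌋` of `f^*E_*` at `y`. -/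
def pullbackWeights (y : (f ⁻¹' D : Set Y)) : Finset ℝ :=
  Finset.univ.image fun k => Int.fract (scaledWeight S f y k)

/-- The index, among the weights of `f^*E_*` at `y`, of the weight of the `k`-th line bundle. -/
def pullbackPos (y : (f ⁻¹' D : Set Y)) (k : Fin (finrank ℂ F)) :
    Fin (pullbackWeights S f y).card :=
  ((pullbackWeights S f y).orderIsoOfFin rfl).symm
    ⟨Int.fract (scaledWeight S f y k), Finset.mem_image_of_mem _ (Finset.mem_univ k)⟩

theorem pullbackPos_surjective (y : (f ⁻¹' D : Set Y)) :
    Function.Surjective (pullbackPos S f y) := by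
  intro i
  obtain ⟨k, -, hk⟩ := Finset.mem_image.1 ((pullbackWeights S f y).orderIsoOfFin rfl i).2
  refine ⟨k, ?_⟩
  rw [pullbackPos, OrderIso.symm_apply_eq]
  exact Subtype.ext hk

/-- The flag of `f^*E_*` at `y`: the `i`-th subspace is the sum of the fibres at `y` of the line
bundles whose weight is at least the `i`-th weight. -/
def pullbackFlag (y : (f ⁻¹' D : Set Y)) (i : Fin ((pullbackWeights S f y).card + 1)) :
    Submodule ℂ (PullbackFiber S f y) :=
  (Submodule.pi {k | (pullbackPos S f y k).castSucc < i} fun _ => ⊥ :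
    Submodule ℂ (Fin (finrank ℂ F) → ℂ))

/-- The parabolic structure of `f^*E_*`, over `f⁻¹(D)`. -/
def parabolicPullback : ParabolicStructure (PullbackFiber S f) (f ⁻¹' D) where
  finite_divisor := f.finite_preimage P.finite_divisor
  length y := (pullbackWeights S f y).card
  flag := pullbackFlag S f
  flag_zero y := by simp [pullbackFlag]; rfl
  flag_last y := by
    refine (Submodule.eq_bot_iff _).2 fun v hv => funext fun k => ?_
    exact hv k (Fin.castSucc_lt_last _)
  flag_strictAnti y := by
    intro i j hij
    refine lt_of_le_of_ne (fun v hv k hk => hv k (lt_trans hk hij)) fun heq => ?_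
    obtain ⟨k, hk⟩ := pullbackPos_surjective S f y ⟨i, by omega⟩
    have h1 : (Pi.single k 1 : Fin (finrank ℂ F) → ℂ) ∈ pullbackFlag S f y i := by
      intro l hl
      rcases eq_or_ne l k with rfl | hlk
      · exact absurd hl (by simp [hk])
      · simp [hlk]
    rw [← heq] at h1
    have := h1 k (by simpa [hk] using hij)
    simp at this
  weight y := (pullbackWeights S f y).orderEmbOfFin rfl
  weight_strictMono y := OrderEmbedding.strictMono _
  weight_nonneg y j := by
    obtain ⟨k, -, hk⟩ := Finset.mem_image.1
      ((pullbackWeights S f y).orderEmbOfFin_mem rfl j)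
    rw [← hk]
    exact Int.fract_nonneg _
  weight_lt_one y j := by
    obtain ⟨k, -, hk⟩ := Finset.mem_image.1
      ((pullbackWeights S f y).orderEmbOfFin_mem rfl j)
    rw [← hk]
    exact Int.fract_lt_one _

variable {S f} [∀ x, IsTopologicalAddGroup (E x)] [∀ x, ContinuousSMul ℂ (E x)]

/-- The value at `y ∉ f⁻¹(D)` of the pullback `f^*θ`, which maps the tangent space at `y` to
`End(E_{f(y)})`. -/
def LogHiggsField.pullbackForm (θ : LogHiggsField F E D) (f : NonconstHolMap Y X)
    (y : ((f ⁻¹' D)ᶜ : Set Y)) :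
    TangentSpace 𝓘(ℂ) (y : Y) →L[ℂ] (E (f y) →L[ℂ] E (f y)) :=
  (θ.form ⟨f y, y.2⟩).comp (mfderiv 𝓘(ℂ) 𝓘(ℂ) f (y : Y))

/-- `θ'` extends `f^*θ`: over `Y ∖ f⁻¹(D)` they correspond to each other under the canonical
identification of the bundles. -/
def HiggsField.ExtendsPullback (θ : HiggsField F P)
    (θ' : HiggsField (Fin (finrank ℂ F) → ℂ) (parabolicPullback S f)) : Prop :=
  ∀ (y : ((f ⁻¹' D)ᶜ : Set Y)) (v : TangentSpace 𝓘(ℂ) (y : Y)) (e : E (f y)),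
    θ'.form y v (pullbackIso S f y e) = pullbackIso S f y (θ.pullbackForm f y v e)

end Pullback

end ParHiggs

end

/-!
The Higgs field `f^*θ` is computed in the trivialization of `f^*E_*` at a point `c` of `Y`. Let `z`
be the coordinate centred at `c` and `w` the one centred at `f c`, pulled back by `f`, so that
`w = z ^ m * u` with `m` the multiplicity and `u` nonvanishing.

Outside `f⁻¹(D)` there is no twist, and `f^*θ = (B ∘ f) dw` with `dw` a holomorphic multiple of `dz`.
At a point of `f⁻¹(D)`, where `θ = B dw / w` in an adapted frame, the matrix of `f^*θ` has entries
`z ^ (t k - t l) * B k l ∘ f` times `dw / w = h dz / z`, with `t k = ⌊m α k⌋` the twists and `h c = m`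
(`exists_factorization_and_logDeriv`). A pole could only come from entries with `t k < t l`. But then
`α k < α l`, so `B k l` vanishes at `f c` because the residue preserves the flag; hence `B k l ∘ f`
vanishes to order at least `m`, while `t l < m` because the weights are less than `1`
(`exists_holomorphic_twist`, `HiggsField.exists_pullback_matrix_at`).

The entries of the residue at `c` are thus `m * B k l (f c)` if `t k = t l`, and `0` otherwise. For
equal twists the order of the weights `m α k - t k` is that of the `α k`
(`pullbackPos_le_iff_weight_le`), so the residue is block triangular, or strictly block triangular if
that of `θ` is, with respect to the new flag. Uniqueness holds because the canonical identification
determines the form outside `f⁻¹(D)`, and the residues are limits of it (`LogHiggsField.eq_of_form_eq`).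
-/

noncomputable section

namespace ParHiggs

/-! ### Holomorphic functions and their differentials in a local coordinate -/

section LocalAnalysis

variable {Y : Type*} [TopologicalSpace Y] [ChartedSpace ℂ Y]

/-- The differential of a function, with values in `ℂ` rather than in a tangent space of `ℂ`. -/
def differential (g : Y → ℂ) (p : Y) : TangentSpace 𝓘(ℂ) p →L[ℂ] ℂ := mfderiv 𝓘(ℂ) 𝓘(ℂ) g p

theorem coord_self (c : Y) : coord c c = 0 := sub_self _

theorem coord_ne_zero {c p : Y} (hp : p ∈ (chartAt ℂ c).source) (h : p ≠ c) : coord c p ≠ 0 :=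
  fun h0 => h ((chartAt ℂ c).injOn hp (mem_chart_source ℂ c) (sub_eq_zero.1 h0))

theorem eventually_mem_chart_source (c : Y) : ∀ᶠ p in 𝓝 c, p ∈ (chartAt ℂ c).source :=
  chart_source_mem_nhds ℂ c

theorem eventually_chartAt {c : Y} {Q : ℂ → Prop} (h : ∀ᶠ z in 𝓝 (chartAt ℂ c c), Q z) :
    ∀ᶠ p in 𝓝 c, Q (chartAt ℂ c p) :=
  ((chartAt ℂ c).continuousAt (mem_chart_source ℂ c)).eventually h

/-- A Riemann surface has no isolated points. -/
theorem nhdsNE_neBot (c : Y) : (𝓝[≠] c).NeBot := by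
  have h := (chartAt ℂ c).symm.continuousAt (mem_chart_target ℂ c)
  rw [ContinuousAt, (chartAt ℂ c).left_inv (mem_chart_source ℂ c)] at h
  refine Filter.NeBot.mono (f := map (chartAt ℂ c).symm (𝓝[≠] (chartAt ℂ c c))) inferInstance ?_
  refine tendsto_nhdsWithin_iff.2 ⟨h.mono_left nhdsWithin_le_nhds, ?_⟩
  filter_upwards [self_mem_nhdsWithin,
    nhdsWithin_le_nhds ((chartAt ℂ c).open_target.mem_nhds (mem_chart_target ℂ c))] with z hz hzt hzc
  refine hz ?_
  rw [← (chartAt ℂ c).right_inv hzt, mem_singleton_iff.1 hzc]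
  rfl

/-- A holomorphic function is an analytic function of the coordinate of a chart. -/
theorem analyticAt_comp_chartAt_symm {g : Y → ℂ} {c : Y} (hg : ContMDiffAt 𝓘(ℂ) 𝓘(ℂ) ω g c) :
    AnalyticAt ℂ (fun z => g ((chartAt ℂ c).symm z)) (chartAt ℂ c c) := by
  have h := (contMDiffAt_iff.1 hg).2
  simp only [extChartAt, mfld_simps] at h
  rw [contDiffWithinAt_univ] at h
  exact h.analyticAt

theorem eventually_eq_comp_chartAt (g : Y → ℂ) (c : Y) :
    ∀ᶠ p in 𝓝 c, g p = g ((chartAt ℂ c).symm (chartAt ℂ c p)) := by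
  filter_upwards [eventually_mem_chart_source c] with p hp
  rw [(chartAt ℂ c).left_inv hp]

variable [IsManifold 𝓘(ℂ) ω Y]

theorem contMDiffAt_comp_chartAt {G : ℂ → ℂ} {c : Y} (hG : AnalyticAt ℂ G (chartAt ℂ c c)) :
    ContMDiffAt 𝓘(ℂ) 𝓘(ℂ) ω (fun p => G (chartAt ℂ c p)) c :=
  hG.contDiffAt.contMDiffAt.comp c
    ((contMDiffOn_chart (I := 𝓘(ℂ)) (n := ω) (x := c)).contMDiffAt (chart_source_mem_nhds ℂ c))

/-- A holomorphic function vanishing at `c` is divisible by the coordinate centred at `c`. -/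
theorem exists_eq_coord_mul {g : Y → ℂ} {c : Y} (hg : ContMDiffAt 𝓘(ℂ) 𝓘(ℂ) ω g c)
    (h0 : g c = 0) : ∃ g₁ : Y → ℂ, ContMDiffAt 𝓘(ℂ) 𝓘(ℂ) ω g₁ c ∧
      ∀ᶠ p in 𝓝 c, g p = coord c p * g₁ p := by
  have han := analyticAt_comp_chartAt_symm hg
  have hord : ((1 : ℕ) : ℕ∞) ≤
      analyticOrderAt (fun z => g ((chartAt ℂ c).symm z)) (chartAt ℂ c c) := by
    rw [Nat.cast_one, Order.one_le_iff_ne_zero, han.analyticOrderAt_ne_zero,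
      (chartAt ℂ c).left_inv (mem_chart_source ℂ c), h0]
  obtain ⟨G, hG, hev⟩ := (natCast_le_analyticOrderAt han).1 hord
  refine ⟨_, contMDiffAt_comp_chartAt hG, ?_⟩
  filter_upwards [eventually_chartAt hev, eventually_eq_comp_chartAt g c] with p h1 h2
  rw [h2, h1, pow_one, smul_eq_mul]
  rfl

theorem contMDiffAt_coord_of_mem_source {c p : Y} (hp : p ∈ (chartAt ℂ c).source) :
    ContMDiffAt 𝓘(ℂ) 𝓘(ℂ) ω (coord c) p :=
  ((contMDiffOn_chart (I := 𝓘(ℂ)) (n := ω) (x := c)).contMDiffAt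
    ((chartAt ℂ c).open_source.mem_nhds hp)).sub contMDiffAt_const

theorem hasMFDerivAt_coord {c p : Y} (hp : p ∈ (chartAt ℂ c).source) :
    HasMFDerivAt 𝓘(ℂ) 𝓘(ℂ) (coord c) p (dcoord c p) :=
  ((contMDiffAt_coord_of_mem_source hp).mdifferentiableAt (by simp)).hasMFDerivAt

/-- The differential of a holomorphic function in terms of the derivative of its expression in a
chart. -/
theorem eventually_differential_eq {g : Y → ℂ} {G : ℂ → ℂ} {c : Y}
    (hG : AnalyticAt ℂ G (chartAt ℂ c c)) (h : ∀ᶠ p in 𝓝 c, g p = G (chartAt ℂ c p)) :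
    ∀ᶠ p in 𝓝 c, ∀ v : TangentSpace 𝓘(ℂ) p,
      differential g p v =
        deriv G (chartAt ℂ c p) * dcoord c p v := by
  filter_upwards [eventually_chartAt hG.eventually_analyticAt, h.eventually_nhds,
    eventually_mem_chart_source c] with p hGp hp hpc v
  have hd : HasDerivAt (fun z => G (z + chartAt ℂ c c)) (deriv G (chartAt ℂ c p))
      (coord c p) := by
    refine HasDerivAt.comp_add_const _ _ ?_
    rw [coord, sub_add_cancel]
    exact hGp.differentiableAt.hasDerivAt
  have hm := (hd.hasFDerivAt.hasMFDerivAt.comp p (hasMFDerivAt_coord hpc)).congr_of_eventuallyEq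
    (f₁ := g) (by
      filter_upwards [hp] with q hq
      rw [hq, Function.comp_apply, coord, sub_add_cancel])
  rw [differential, hm.mfderiv, mul_comm]
  rfl

/-- The differential of a holomorphic function is a holomorphic multiple of the differential of a
local coordinate. -/
theorem exists_differential_eq_mul_dcoord {g : Y → ℂ} {c : Y} (hg : ContMDiffAt 𝓘(ℂ) 𝓘(ℂ) ω g c) :
    ∃ h : Y → ℂ, ContMDiffAt 𝓘(ℂ) 𝓘(ℂ) ω h c ∧ ∀ᶠ p in 𝓝 c, ∀ v : TangentSpace 𝓘(ℂ) p,
      differential g p v = h p * dcoord c p v :=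
  ⟨_, contMDiffAt_comp_chartAt (analyticAt_comp_chartAt_symm hg).deriv,
    eventually_differential_eq (analyticAt_comp_chartAt_symm hg) (eventually_eq_comp_chartAt g c)⟩

theorem exists_dcoord_ne_zero {c p : Y} (hp : p ∈ (chartAt ℂ c).source) :
    ∃ v : TangentSpace 𝓘(ℂ) p, dcoord c p v ≠ 0 := by
  have hm : MDifferentiableAt 𝓘(ℂ) 𝓘(ℂ) (chartAt ℂ c) p :=
    ((contMDiffOn_chart (I := 𝓘(ℂ)) (n := ω) (x := c)).contMDiffAt
      ((chartAt ℂ c).open_source.mem_nhds hp)).mdifferentiableAt (by simp)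
  have h1 : dcoord c p = mfderiv 𝓘(ℂ) 𝓘(ℂ) (chartAt ℂ c) p := by
    refine HasMFDerivAt.mfderiv ?_
    have := hm.hasMFDerivAt.sub (hasMFDerivAt_const (I := 𝓘(ℂ)) (chartAt ℂ c c) p)
    exact this.congr_mfderiv
      (sub_zero (mfderiv 𝓘(ℂ) 𝓘(ℂ) (chartAt ℂ c) p : TangentSpace 𝓘(ℂ) p →L[ℂ] ℂ))
  have : IsManifold 𝓘(ℂ) 1 Y := IsManifold.of_le (n := ω) le_top
  let one : TangentSpace 𝓘(ℂ) (chartAt ℂ c p) := (1 : ℂ)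
  obtain ⟨v, hv⟩ := ((mdifferentiable_chart (I := 𝓘(ℂ)) c).mfderiv_surjective hp) one
  refine ⟨v, ?_⟩
  rw [h1]
  intro h0
  exact one_ne_zero (α := ℂ) (hv.symm.trans h0)

/-- A holomorphic function `w` which is not locally zero is `z ^ m * u` with `u` nonvanishing, `z`
being the coordinate centred at `c`, and then `dw / w = h dz / z` with `h = m + z u' / u`. -/
theorem exists_factorization_and_logDeriv {g : Y → ℂ} {c : Y}
    (hg : ContMDiffAt 𝓘(ℂ) 𝓘(ℂ) ω g c) (hnt : ∃ᶠ p in 𝓝 c, g p ≠ 0) :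
    ∃ m : ℕ, m = analyticOrderNatAt (fun z => g ((chartAt ℂ c).symm z)) (chartAt ℂ c c) ∧
      (∃ u : Y → ℂ, ContMDiffAt 𝓘(ℂ) 𝓘(ℂ) ω u c ∧ u c ≠ 0 ∧
        ∀ᶠ p in 𝓝 c, g p = coord c p ^ m * u p) ∧
      ∃ h : Y → ℂ, ContMDiffAt 𝓘(ℂ) 𝓘(ℂ) ω h c ∧ h c = m ∧
        ∀ᶠ p in 𝓝 c, ∀ v : TangentSpace 𝓘(ℂ) p,
          coord c p * differential g p v =
            h p * g p * dcoord c p v := by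
  have han := analyticAt_comp_chartAt_symm hg
  have hord : analyticOrderAt (fun z => g ((chartAt ℂ c).symm z)) (chartAt ℂ c c) ≠ ⊤ := by
    intro htop
    obtain ⟨p, hp, h1, h2⟩ := (hnt.and_eventually ((eventually_chartAt
      (analyticOrderAt_eq_top.1 htop)).and (eventually_eq_comp_chartAt g c))).exists
    exact hp (h2.trans h1)
  obtain ⟨U, hU, hU0, hev⟩ := han.analyticOrderAt_ne_top.1 hord
  set m := analyticOrderNatAt (fun z => g ((chartAt ℂ c).symm z)) (chartAt ℂ c c)
  set z₀ := chartAt ℂ c c with hz₀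
  have hUev : ∀ᶠ z in 𝓝 z₀, U z ≠ 0 := hU.continuousAt.eventually_ne hU0
  refine ⟨m, rfl, ⟨_, contMDiffAt_comp_chartAt hU, hU0, ?_⟩,
    fun p => m + coord c p * (deriv U (chartAt ℂ c p) / U (chartAt ℂ c p)), ?_, ?_, ?_⟩
  · filter_upwards [eventually_chartAt hev, eventually_eq_comp_chartAt g c] with p h1 h2
    rw [h2, h1, smul_eq_mul]
    rfl
  · exact contMDiffAt_const.add ((contMDiffAt_coord_of_mem_source (mem_chart_source ℂ c)).mul
      (contMDiffAt_comp_chartAt (hU.deriv.div hU hU0)))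
  · simp [coord_self]
  · filter_upwards [eventually_differential_eq han (eventually_eq_comp_chartAt g c),
      eventually_eq_comp_chartAt g c, eventually_chartAt hev.eventually_nhds,
      eventually_chartAt hUev, eventually_chartAt hU.eventually_analyticAt] with p h1 h2 h3 h4 h5 v
    have hd : HasDerivAt (fun z => (z - z₀) ^ m * U z)
        (m * (chartAt ℂ c p - z₀) ^ (m - 1) * 1 * U (chartAt ℂ c p) +
          (chartAt ℂ c p - z₀) ^ m * deriv U (chartAt ℂ c p)) (chartAt ℂ c p) :=
      (((hasDerivAt_id _).sub_const z₀).pow m).mul h5.differentiableAt.hasDerivAt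
    have h3' : (fun z => g ((chartAt ℂ c).symm z)) =ᶠ[𝓝 (chartAt ℂ c p)]
        fun z => (z - z₀) ^ m * U z := h3
    rw [h1 v, h3'.deriv_eq, hd.deriv, h2, h3.self_of_nhds, smul_eq_mul, coord, ← hz₀, ← mul_assoc]
    congr 1
    -- the exponent `m - 1` in the derivative is truncated for `m = 0`
    rcases Nat.eq_zero_or_pos m with hm | hm
    · rw [hm]
      field_simp
      simp
    · obtain ⟨n, hn⟩ := Nat.exists_eq_succ_of_ne_zero hm.ne'
      rw [hn]
      field_simp
      simp only [Nat.succ_sub_one, Nat.succ_eq_add_one]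
      ring

end LocalAnalysis

/-! ### Sections of the endomorphism bundle -/

section HomBundle

variable {Y : Type*} [TopologicalSpace Y] [ChartedSpace ℂ Y]
  {F : Type*} [NormedAddCommGroup F] [NormedSpace ℂ F]
  {V : Y → Type*} [∀ x, AddCommGroup (V x)] [∀ x, Module ℂ (V x)]
  [TopologicalSpace (TotalSpace F V)] [∀ x, TopologicalSpace (V x)] [FiberBundle F V]
  [VectorBundle ℂ F V] [∀ x, IsTopologicalAddGroup (V x)] [∀ x, ContinuousSMul ℂ (V x)]

/-- A function with values in the endomorphisms of the model fibre gives a section of `End(V)`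
near `c`, by means of the trivialization at `c`. -/
def endSection (V : Y → Type*) [∀ x, AddCommGroup (V x)] [∀ x, Module ℂ (V x)]
    [TopologicalSpace (TotalSpace F V)] [∀ x, TopologicalSpace (V x)] [FiberBundle F V]
    [VectorBundle ℂ F V] (c : Y) (N : Y → F →L[ℂ] F) (p : Y) : V p →L[ℂ] V p :=
  ((trivializationAt F V c).symmL ℂ p).comp
    ((N p).comp ((trivializationAt F V c).continuousLinearMapAt ℂ p))

theorem eventually_mem_trivializationAt_baseSet (c : Y) :
    ∀ᶠ p in 𝓝 c, p ∈ (trivializationAt F V c).baseSet :=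
  (trivializationAt F V c).open_baseSet.mem_nhds (FiberBundle.mem_baseSet_trivializationAt' c)

theorem continuousLinearMapAt_endSection {c p : Y} (hp : p ∈ (trivializationAt F V c).baseSet)
    (N : Y → F →L[ℂ] F) (v : V p) :
    (trivializationAt F V c).continuousLinearMapAt ℂ p (endSection V c N p v) =
      N p ((trivializationAt F V c).continuousLinearMapAt ℂ p v) := by
  simp only [endSection, ContinuousLinearMap.comp_apply]
  exact (trivializationAt F V c).continuousLinearMapAt_symmL hp _

theorem contMDiffAt_endSection {c : Y} {N : Y → F →L[ℂ] F}
    (hN : ContMDiffAt 𝓘(ℂ) 𝓘(ℂ, F →L[ℂ] F) ω N c) :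
    ContMDiffAt 𝓘(ℂ) (𝓘(ℂ).prod 𝓘(ℂ, F →L[ℂ] F)) ω
      (fun x => TotalSpace.mk' (F →L[ℂ] F) (E := fun x => V x →L[ℂ] V x) x
        (endSection V c N x)) c := by
  refine (contMDiffAt_hom_bundle _).2 ⟨contMDiffAt_id, hN.congr_of_eventuallyEq ?_⟩
  filter_upwards [eventually_mem_trivializationAt_baseSet (F := F) (V := V) c] with p hp
  refine ContinuousLinearMap.ext fun v => ?_
  simp only [ContinuousLinearMap.inCoordinates, ContinuousLinearMap.comp_apply]
  refine (continuousLinearMapAt_endSection hp N _).trans ?_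
  rw [(trivializationAt F V c).continuousLinearMapAt_symmL hp]

/-- Sections of `End(V)` which are continuous at `c` and agree outside `c` agree at `c`. -/
theorem endSection_unique {c : Y} {B₁ B₂ : ∀ x : Y, V x →L[ℂ] V x}
    (h₁ : ContMDiffAt 𝓘(ℂ) (𝓘(ℂ).prod 𝓘(ℂ, F →L[ℂ] F)) ω
      (fun x => TotalSpace.mk' (F →L[ℂ] F) (E := fun x => V x →L[ℂ] V x) x (B₁ x)) c)
    (h₂ : ContMDiffAt 𝓘(ℂ) (𝓘(ℂ).prod 𝓘(ℂ, F →L[ℂ] F)) ω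
      (fun x => TotalSpace.mk' (F →L[ℂ] F) (E := fun x => V x →L[ℂ] V x) x (B₂ x)) c)
    (h : ∀ᶠ p in 𝓝[≠] c, B₁ p = B₂ p) : B₁ c = B₂ c := by
  have hc := FiberBundle.mem_baseSet_trivializationAt' (F := F) (E := V) c
  have t₁ := ((contMDiffAt_hom_bundle _).1 h₁).2.continuousAt
  have t₂ := ((contMDiffAt_hom_bundle _).1 h₂).2.continuousAt
  have := nhdsNE_neBot c
  have heq := tendsto_nhds_unique (t₁.mono_left (nhdsWithin_le_nhds (s := {c}ᶜ)))
    ((t₂.mono_left (nhdsWithin_le_nhds (s := {c}ᶜ))).congr' (by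
      filter_upwards [h] with p hp
      simp only [hp]))
  refine ContinuousLinearMap.ext fun v => ?_
  have h3 := congrArg (fun A : F →L[ℂ] F => (trivializationAt F V c).symmL ℂ c
    (A ((trivializationAt F V c).continuousLinearMapAt ℂ c v))) heq
  simpa only [ContinuousLinearMap.inCoordinates, ContinuousLinearMap.comp_apply,
    (trivializationAt F V c).symmL_continuousLinearMapAt hc] using h3

end HomBundle

/-! ### Vanishing orders and twists -/

section Order

variable {X Y : Type*} [TopologicalSpace X] [ChartedSpace ℂ X] [IsManifold 𝓘(ℂ) ω X]
  [TopologicalSpace Y] [ChartedSpace ℂ Y] [IsManifold 𝓘(ℂ) ω Y]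

/-- If `φ` has multiplicity `m` at `c`, `z` is the coordinate at `c` and `b` is holomorphic near
`φ c`, then `z ^ (s - t) * b ∘ φ` is holomorphic if `s ≥ t`, or if `b` vanishes at `φ c` and
`t < m`: in the latter case `b ∘ φ` vanishes to order at least `m` at `c`. -/
theorem exists_holomorphic_twist {φ : Y → X} {c : Y} (hφ : ContMDiffAt 𝓘(ℂ) 𝓘(ℂ) ω φ c)
    {m : ℕ} {u : Y → ℂ} (hu : ContMDiffAt 𝓘(ℂ) 𝓘(ℂ) ω u c)
    (hw : ∀ᶠ p in 𝓝 c, coord (φ c) (φ p) = coord c p ^ m * u p)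
    {b : X → ℂ} (hb : ContMDiffAt 𝓘(ℂ) 𝓘(ℂ) ω b (φ c)) {s t : ℕ}
    (hb0 : s < t → b (φ c) = 0) (ht : s < t → t < m) :
    ∃ n : Y → ℂ, ContMDiffAt 𝓘(ℂ) 𝓘(ℂ) ω n c ∧ n c = (if s = t then b (φ c) else 0) ∧
      ∀ᶠ p in 𝓝 c, n p * coord c p ^ t = coord c p ^ s * b (φ p) := by
  have hz := contMDiffAt_coord_of_mem_source (mem_chart_source ℂ c)
  rcases lt_or_ge s t with h | h
  · obtain ⟨b₁, hb₁, hev⟩ := exists_eq_coord_mul hb (hb0 h)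
    refine ⟨fun p => coord c p ^ (s + (m - t)) * (u p * b₁ (φ p)),
      (hz.pow _).mul (hu.mul (hb₁.comp c hφ)), ?_, ?_⟩
    · have := ht h
      simp only [coord_self, zero_pow (show s + (m - t) ≠ 0 by omega), zero_mul, if_neg h.ne]
    · filter_upwards [hw, hφ.continuousAt.eventually hev] with p h1 h2
      have hm : coord c p ^ m = coord c p ^ (m - t) * coord c p ^ t := by
        rw [← pow_add, Nat.sub_add_cancel (ht h).le]
      rw [h2, h1, hm, pow_add]
      ring
  · refine ⟨fun p => coord c p ^ (s - t) * b (φ p), (hz.pow _).mul (hb.comp c hφ), ?_, ?_⟩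
    · split_ifs with hst
      · simp [hst]
      · simp only [coord_self, zero_pow (show s - t ≠ 0 by omega), zero_mul]
    · refine Filter.Eventually.of_forall fun p => ?_
      have : coord c p ^ s = coord c p ^ (s - t) * coord c p ^ t := by
        rw [← pow_add, Nat.sub_add_cancel h]
      rw [this]
      ring

/-- The chain rule for the pullback of a local coordinate. -/
theorem eventually_differential_coord_comp {φ : Y → X} (hφ : ContMDiff 𝓘(ℂ) 𝓘(ℂ) ω φ) (c : Y) :
    ∀ᶠ p in 𝓝 c, ∀ v : TangentSpace 𝓘(ℂ) p,
      differential (fun q => coord (φ c) (φ q)) p v =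
        dcoord (φ c) (φ p) (mfderiv 𝓘(ℂ) 𝓘(ℂ) φ p v) := by
  filter_upwards [hφ.continuous.continuousAt.eventually (eventually_mem_chart_source (φ c))]
    with p hp v
  exact congrArg (fun A : TangentSpace 𝓘(ℂ) p →L[ℂ] ℂ => A v) ((hasMFDerivAt_coord hp).comp p
    ((hφ p).mdifferentiableAt (by simp)).hasMFDerivAt).mfderiv

end Order

/-! ### The residue in an adapted frame -/

section Residue

variable {X : Type*} [TopologicalSpace X] [ChartedSpace ℂ X]
  {F : Type*} [NormedAddCommGroup F] [NormedSpace ℂ F]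
  {E : X → Type*} [∀ x, AddCommGroup (E x)] [∀ x, Module ℂ (E x)]
  [TopologicalSpace (TotalSpace F E)] [∀ x, TopologicalSpace (E x)] [FiberBundle F E]
  {D : Set X} {P : ParabolicStructure E D}

theorem ParabolicStructure.Splitting.frame_mem_flag (S : P.Splitting F) (x : D)
    {i : Fin (P.length x + 1)} {l : Fin (finrank ℂ F)} (h : i ≤ (S.pos x l).castSucc) :
    S.frame x l x ∈ P.flag x i := by
  rw [S.flag_eq]
  exact Submodule.subset_span ⟨l, h, rfl⟩

theorem ParabolicStructure.Splitting.coeff_eq_zero_of_mem_flag (S : P.Splitting F) (x : D)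
    {i : Fin (P.length x + 1)} {k : Fin (finrank ℂ F)} (h : (S.pos x k).castSucc < i) {v : E x}
    (hv : v ∈ P.flag x i) : (S.isLocalFrameOn x).coeff k x v = 0 := by
  rw [S.flag_eq] at hv
  suffices hle : Submodule.span ℂ {v | ∃ k, i ≤ (S.pos x k).castSucc ∧ v = S.frame x k x} ≤
      LinearMap.ker ((S.isLocalFrameOn x).coeff k x) from hle hv
  refine Submodule.span_le.2 ?_
  rintro _ ⟨j, hj, rfl⟩
  have hjk : j ≠ k := by
    rintro rfl
    exact absurd h (not_lt.2 hj)
  change (S.isLocalFrameOn x).coeff k x (S.frame x j x) = 0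
  rw [(S.isLocalFrameOn x).coeff_apply_of_mem (S.mem_nbhd x),
    ← (S.isLocalFrameOn x).toBasisAt_coe (S.mem_nbhd x) j, Basis.repr_self,
    Finsupp.single_apply, if_neg hjk]

variable [VectorBundle ℂ F E] [∀ x, IsTopologicalAddGroup (E x)]
  [∀ x, ContinuousSMul ℂ (E x)]

/-- The residue of a Higgs field is block triangular in an adapted frame. -/
theorem HiggsField.coeff_res_eq_zero (θ : HiggsField F P) (S : P.Splitting F) (x : D)
    {k l : Fin (finrank ℂ F)} (h : P.weight x (S.pos x k) < P.weight x (S.pos x l)) :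
    (S.isLocalFrameOn x).coeff k x (θ.res x (S.frame x l x)) = 0 :=
  S.coeff_eq_zero_of_mem_flag x
    (Fin.castSucc_lt_castSucc_iff.2 ((P.weight_strictMono x).lt_iff_lt.1 h))
    (θ.preserves x _ _ (S.frame_mem_flag x le_rfl))

/-- The residue of a strongly parabolic Higgs field is strictly block triangular in an adapted
frame. -/
theorem HiggsField.IsStrong.coeff_res_eq_zero {θ : HiggsField F P} (hθ : θ.IsStrong)
    (S : P.Splitting F) (x : D) {k l : Fin (finrank ℂ F)}
    (h : P.weight x (S.pos x k) ≤ P.weight x (S.pos x l)) :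
    (S.isLocalFrameOn x).coeff k x (θ.res x (S.frame x l x)) = 0 :=
  S.coeff_eq_zero_of_mem_flag x
    (Fin.castSucc_lt_succ_iff.2 ((P.weight_strictMono x).le_iff_le.1 h))
    (hθ x _ _ (S.frame_mem_flag x le_rfl))

end Residue

/-! ### Trivializations of the pullback -/

section Pullback

variable {X Y : Type*} [TopologicalSpace X] [ChartedSpace ℂ X] [IsManifold 𝓘(ℂ) ω X] [T2Space X]
  [TopologicalSpace Y] [ChartedSpace ℂ Y] [IsManifold 𝓘(ℂ) ω Y] [T2Space Y] [CompactSpace Y]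
  [ConnectedSpace Y]
  {F : Type*} [NormedAddCommGroup F] [NormedSpace ℂ F] [FiniteDimensional ℂ F]
  {E : X → Type*} [∀ x, AddCommGroup (E x)] [∀ x, Module ℂ (E x)]
  [TopologicalSpace (TotalSpace F E)] [∀ x, TopologicalSpace (E x)] [FiberBundle F E]
  [VectorBundle ℂ F E]
  {D : Set X} {P : ParabolicStructure E D} {S : P.Splitting F} {f : NonconstHolMap Y X}

theorem eventually_mem_pullbackBaseSet (c : Y) : ∀ᶠ p in 𝓝 c, p ∈ pullbackBaseSet S f c :=
  (isOpen_pullbackBaseSet c).mem_nhds ((pullbackCore S f).mem_baseSet_at c)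

theorem mem_pullbackBaseSet_self (c : Y) : c ∈ pullbackBaseSet S f c :=
  (pullbackCore S f).mem_baseSet_at c

/-- The trivialization of `f^*E_*` at `c` is the identity on the fibre at `c`. -/
theorem pullback_continuousLinearMapAt_self (c : Y) (v : PullbackFiber S f c) :
    (trivializationAt (Fin (finrank ℂ F) → ℂ) (PullbackFiber S f) c).continuousLinearMapAt ℂ c v
      = v := by
  rw [VectorBundleCore.trivializationAt_continuousLinearMapAt _ (mem_pullbackBaseSet_self c)]
  exact (pullbackCore S f).coordChange_self c c (mem_pullbackBaseSet_self c) v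

theorem pullback_continuousLinearMapAt_injective {c p : Y} (hp : p ∈ pullbackBaseSet S f c) :
    Function.Injective ((trivializationAt (Fin (finrank ℂ F) → ℂ)
      (PullbackFiber S f) c).continuousLinearMapAt ℂ p) :=
  Function.LeftInverse.injective (g := (trivializationAt (Fin (finrank ℂ F) → ℂ)
    (PullbackFiber S f) c).symmL ℂ p) fun v =>
      (trivializationAt _ (PullbackFiber S f) c).symmL_continuousLinearMapAt hp v

theorem pullback_continuousLinearMapAt_iso {c : Y} (p : ((f ⁻¹' D)ᶜ : Set Y))
    (hp : (p : Y) ∈ pullbackBaseSet S f c) (v : E (f p)) (k : Fin (finrank ℂ F)) :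
    (trivializationAt (Fin (finrank ℂ F) → ℂ) (PullbackFiber S f) c).continuousLinearMapAt ℂ
        (p : Y) (pullbackIso S f p v) k =
      coord c p ^ twist S f c k * (S.isLocalFrameOn (f c)).coeff k (f p) v := by
  rw [VectorBundleCore.trivializationAt_continuousLinearMapAt _ hp]
  exact localTriv_pullbackIso S f c p v k

theorem NonconstHolMap.eventually_ne (f : NonconstHolMap Y X) (c : Y) :
    ∀ᶠ p in 𝓝[≠] c, f p ≠ f c := by
  have hfin : ((f ⁻¹' {f c}) \ {c}).Finite :=
    (f.finite_preimage (finite_singleton (f c))).subset sdiff_subset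
  rw [eventually_nhdsWithin_iff]
  filter_upwards [hfin.isClosed.isOpen_compl.mem_nhds (fun h => h.2 rfl)] with p hp hpc h
  exact hp ⟨h, hpc⟩

theorem NonconstHolMap.frequently_coord_ne_zero (f : NonconstHolMap Y X) (c : Y) :
    ∃ᶠ p in 𝓝 c, coord (f c) (f p) ≠ 0 := by
  have := nhdsNE_neBot c
  refine Frequently.filter_mono (f := 𝓝[≠] c) (Eventually.frequently ?_) nhdsWithin_le_nhds
  filter_upwards [f.eventually_ne c, nhdsWithin_le_nhds
    (f.holomorphic.continuous.continuousAt.eventually (eventually_mem_chart_source (f c)))]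
    with p h1 h2
  exact coord_ne_zero h2 h1

theorem NonconstHolMap.contMDiffAt_coord_comp (f : NonconstHolMap Y X) (c : Y) :
    ContMDiffAt 𝓘(ℂ) 𝓘(ℂ) ω (fun p => coord (f c) (f p)) c :=
  (contMDiffAt_coord_of_mem_source (mem_chart_source ℂ (f c))).comp c (f.holomorphic c)

theorem NonconstHolMap.multiplicity_pos (f : NonconstHolMap Y X) (c : Y) :
    0 < multiplicity f c := by
  obtain ⟨m, hm, ⟨u, -, hu0, hu⟩, -⟩ :=
    exists_factorization_and_logDeriv (f.contMDiffAt_coord_comp c) (f.frequently_coord_ne_zero c)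
  have hm' : m = multiplicity f c := hm
  have h := hu.self_of_nhds
  simp only [coord_self] at h
  refine hm' ▸ Nat.pos_of_ne_zero fun h0 => hu0 ?_
  rwa [h0, pow_zero, one_mul, eq_comm] at h

variable (S) in
/-- The canonical identification of `f^*E` with the bundle underlying `f^*E_*`, as a continuous
linear equivalence on fibres. -/
def pullbackIsoL (y : ((f ⁻¹' D)ᶜ : Set Y)) : E (f y) ≃L[ℂ] PullbackFiber S f y :=
  -- `E (f y)` carries no norm, so continuity is read off on the model fibre `F`
  let φ : E (f y) ≃L[ℂ] F := (trivializationAt F E (f y)).continuousLinearEquivAt ℂ (f y)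
    (FiberBundle.mem_baseSet_trivializationAt' (f y))
  φ.trans (φ.symm.toLinearEquiv.trans ((pullbackIso S f y).trans
    (LinearEquiv.refl ℂ (Fin (finrank ℂ F) → ℂ)))).toContinuousLinearEquiv

theorem pullbackIsoL_apply (y : ((f ⁻¹' D)ᶜ : Set Y)) (e : E (f y)) :
    pullbackIsoL S y e = pullbackIso S f y e := by
  simp only [pullbackIsoL]
  exact congrArg (pullbackIso S f y) (ContinuousLinearEquiv.symm_apply_apply _ e)

variable [∀ x, IsTopologicalAddGroup (E x)] [∀ x, ContinuousSMul ℂ (E x)]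

/-- The form `f^*θ` on `Y ∖ f⁻¹(D)`, carried over to the bundle underlying `f^*E_*`. -/
def LogHiggsField.pullbackEndForm (θ : LogHiggsField F E D) (S : P.Splitting F)
    (y : ((f ⁻¹' D)ᶜ : Set Y)) :
    TangentSpace 𝓘(ℂ) (y : Y) →L[ℂ] (PullbackFiber S f y →L[ℂ] PullbackFiber S f y) :=
  ((pullbackIsoL S y).arrowCongr (pullbackIsoL S y) :
    (E (f y) →L[ℂ] E (f y)) →L[ℂ] (PullbackFiber S f y →L[ℂ] PullbackFiber S f y)).comp
      (θ.pullbackForm f y)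

theorem LogHiggsField.pullbackEndForm_apply (θ : LogHiggsField F E D)
    (y : ((f ⁻¹' D)ᶜ : Set Y)) (v : TangentSpace 𝓘(ℂ) (y : Y)) (e : E (f y)) :
    θ.pullbackEndForm S y v (pullbackIso S f y e) =
      pullbackIso S f y (θ.pullbackForm f y v e) := by
  rw [← pullbackIsoL_apply, ← pullbackIsoL_apply]
  change pullbackIsoL S y (θ.pullbackForm f y v ((pullbackIsoL S y).symm (pullbackIsoL S y e))) = _
  rw [ContinuousLinearEquiv.symm_apply_apply]

/-- In the trivialization at `c`, an endomorphism of a fibre of `f^*E` has the matrix `n` obtained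
from its matrix in the frame at `f c` by conjugation with the powers of `z` given by the twists. -/
theorem pullback_continuousLinearMapAt_iso_map {c : Y} (p : ((f ⁻¹' D)ᶜ : Set Y))
    (hp : (p : Y) ∈ pullbackBaseSet S f c) (T : E (f p) →L[ℂ] E (f p))
    {n : Fin (finrank ℂ F) → Fin (finrank ℂ F) → ℂ}
    (hn : ∀ k l, n k l * coord c p ^ twist S f c l =
      coord c p ^ twist S f c k *
        (S.isLocalFrameOn (f c)).coeff k (f p) (T (S.frame (f c) l (f p)))) (e : E (f p)) :
    (trivializationAt (Fin (finrank ℂ F) → ℂ) (PullbackFiber S f) c).continuousLinearMapAt ℂ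
        (p : Y) (pullbackIso S f p (T e)) =
      matCLM _ n ((trivializationAt (Fin (finrank ℂ F) → ℂ)
        (PullbackFiber S f) c).continuousLinearMapAt ℂ (p : Y) (pullbackIso S f p e)) := by
  funext k
  rw [pullback_continuousLinearMapAt_iso p hp, matCLM_apply]
  simp only [pullback_continuousLinearMapAt_iso p hp]
  conv_lhs => rw [← sum_coeff_frame hp e, map_sum, map_sum, Finset.mul_sum]
  refine Finset.sum_congr rfl fun l _ => ?_
  rw [map_smul, map_smul, smul_eq_mul, ← mul_assoc (n k l), hn]
  ring

theorem contMDiffAt_coeff_end (S : P.Splitting F) {x : X} {B : ∀ x : X, E x →L[ℂ] E x}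
    (hB : ContMDiffAt 𝓘(ℂ) (𝓘(ℂ).prod 𝓘(ℂ, F →L[ℂ] F)) ω
      (fun x => TotalSpace.mk' (F →L[ℂ] F) (E := fun x => E x →L[ℂ] E x) x (B x)) x)
    (k l : Fin (finrank ℂ F)) :
    ContMDiffAt 𝓘(ℂ) 𝓘(ℂ) ω
      (fun x' => (S.isLocalFrameOn x).coeff k x' (B x' (S.frame x l x'))) x :=
  contMDiffAt_coeff (S.isLocalFrameOn x) (S.isOpen_nbhd x) (S.mem_nbhd x)
    (hB.clm_bundle_apply
      ((S.isLocalFrameOn x).contMDiffAt (S.isOpen_nbhd x) (S.mem_nbhd x) l)) k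

/-! ### The matrix of the pulled back form in a trivialization -/

/-- In the trivialization of `f^*E_*` at a point `c` outside `f⁻¹(D)`, the form `f^*θ` is given by
a holomorphic matrix. -/
theorem LogHiggsField.exists_pullback_matrix_off (θ : LogHiggsField F E D) (S : P.Splitting F)
    (c : ((f ⁻¹' D)ᶜ : Set Y)) :
    ∃ N : Y → Fin (finrank ℂ F) → Fin (finrank ℂ F) → ℂ,
      ContMDiffAt 𝓘(ℂ) 𝓘(ℂ, Fin (finrank ℂ F) → Fin (finrank ℂ F) → ℂ) ω N (c : Y) ∧
      ∀ᶠ p in 𝓝 (c : Y), ∀ (hp : p ∈ (f ⁻¹' D)ᶜ) (v : TangentSpace 𝓘(ℂ) p) (e : E (f p)),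
        (trivializationAt (Fin (finrank ℂ F) → ℂ) (PullbackFiber S f)
            (c : Y)).continuousLinearMapAt ℂ p
            (pullbackIso S f ⟨p, hp⟩ (θ.pullbackForm f ⟨p, hp⟩ v e)) =
          dcoord (c : Y) p v • matCLM _ (N p) ((trivializationAt (Fin (finrank ℂ F) → ℂ)
            (PullbackFiber S f) (c : Y)).continuousLinearMapAt ℂ p
              (pullbackIso S f ⟨p, hp⟩ e)) := by
  obtain ⟨B, hB, hBev⟩ := θ.holomorphic_off ⟨f c, c.2⟩
  have hf : ContMDiffAt 𝓘(ℂ) 𝓘(ℂ) ω f (c : Y) := f.holomorphic c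
  have hw := f.contMDiffAt_coord_comp (c : Y)
  obtain ⟨h, hh, hhev⟩ := exists_differential_eq_mul_dcoord hw
  refine ⟨fun p k l => h p * (S.isLocalFrameOn (f c)).coeff k (f p)
    (B (f p) (S.frame (f c) l (f p))), ?_, ?_⟩
  · refine contMDiffAt_pi_space.2 fun k => contMDiffAt_pi_space.2 fun l => hh.mul ?_
    exact (contMDiffAt_coeff_end S hB k l).comp (c : Y) hf
  · filter_upwards [hhev, hf.continuousAt.eventually hBev,
      eventually_differential_coord_comp f.holomorphic (c : Y),
      eventually_mem_pullbackBaseSet (S := S) (f := f) (c : Y)] with p h1 h2 h3 h4 hp v e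
    have hT : θ.pullbackForm f ⟨p, hp⟩ v = dcoord (c : Y) p v • h p • B (f p) := by
      rw [smul_smul, mul_comm, ← h1, h3]
      exact h2 hp _
    have ht : ∀ l, twist S f c l = 0 := fun l => dif_neg c.2
    rw [hT, _root_.smul_apply, map_smul, map_smul,
      pullback_continuousLinearMapAt_iso_map ⟨p, hp⟩ h4 (h p • B (f p))]
    intro k l
    simp [ht]

/-- The matrix of the residue of the pullback of `θ` at a point `c` of `f⁻¹(D)`: the residue of
`θ` is multiplied by the multiplicity of `f`, and only its blocks between line bundles with the
same twist survive. -/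
def HiggsField.pullbackResMatrix (θ : HiggsField F P) (S : P.Splitting F)
    (c : (f ⁻¹' D : Set Y)) (k l : Fin (finrank ℂ F)) : ℂ :=
  multiplicity f (c : Y) * if twist S f c k = twist S f c l then
    (S.isLocalFrameOn (f c)).coeff k (f c) (θ.res ⟨f c, c.2⟩ (S.frame (f c) l (f c))) else 0

theorem twist_eq (c : (f ⁻¹' D : Set Y)) (k : Fin (finrank ℂ F)) :
    twist S f c k = ⌊scaledWeight S f c k⌋₊ := dif_pos c.2

theorem scaledWeight_nonneg (c : (f ⁻¹' D : Set Y)) (k : Fin (finrank ℂ F)) :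
    0 ≤ scaledWeight S f c k :=
  mul_nonneg (Nat.cast_nonneg _) (P.weight_nonneg _ _)

theorem scaledWeight_le_iff (c : (f ⁻¹' D : Set Y)) {k l : Fin (finrank ℂ F)} :
    scaledWeight S f c k ≤ scaledWeight S f c l ↔
      P.weight ⟨f c, c.2⟩ (S.pos ⟨f c, c.2⟩ k) ≤ P.weight ⟨f c, c.2⟩ (S.pos ⟨f c, c.2⟩ l) :=
  mul_le_mul_iff_right₀ (Nat.cast_pos.2 (f.multiplicity_pos c))

/-- The twist is less than the multiplicity because the parabolic weights are less than `1`. -/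
theorem twist_lt_multiplicity (c : (f ⁻¹' D : Set Y)) (k : Fin (finrank ℂ F)) :
    twist S f c k < multiplicity f (c : Y) := by
  have h1 : (twist S f c k : ℝ) ≤ scaledWeight S f c k := by
    rw [twist_eq]
    exact Nat.floor_le (scaledWeight_nonneg c k)
  have h2 : scaledWeight S f c k < multiplicity f (c : Y) :=
    mul_lt_of_lt_one_right (Nat.cast_pos.2 (f.multiplicity_pos c)) (P.weight_lt_one _ _)
  exact_mod_cast h1.trans_lt h2

/-- In the trivialization of `f^*E_*` at a point `c` of `f⁻¹(D)`, the form `f^*θ` is given by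
`dz / z` times a holomorphic matrix. -/
theorem HiggsField.exists_pullback_matrix_at (θ : HiggsField F P) (S : P.Splitting F)
    (c : (f ⁻¹' D : Set Y)) :
    ∃ N : Y → Fin (finrank ℂ F) → Fin (finrank ℂ F) → ℂ,
      ContMDiffAt 𝓘(ℂ) 𝓘(ℂ, Fin (finrank ℂ F) → Fin (finrank ℂ F) → ℂ) ω N (c : Y) ∧
      N c = θ.pullbackResMatrix S c ∧
      ∀ᶠ p in 𝓝 (c : Y), ∀ (hp : p ∈ (f ⁻¹' D)ᶜ) (v : TangentSpace 𝓘(ℂ) p) (e : E (f p)),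
        (trivializationAt (Fin (finrank ℂ F) → ℂ) (PullbackFiber S f)
            (c : Y)).continuousLinearMapAt ℂ p
            (pullbackIso S f ⟨p, hp⟩ (θ.pullbackForm f ⟨p, hp⟩ v e)) =
          (dcoord (c : Y) p v / coord (c : Y) p) •
            matCLM _ (N p) ((trivializationAt (Fin (finrank ℂ F) → ℂ)
              (PullbackFiber S f) (c : Y)).continuousLinearMapAt ℂ p
                (pullbackIso S f ⟨p, hp⟩ e)) := by
  obtain ⟨B, hB, hBc, hBev⟩ := θ.holomorphic_at ⟨f c, c.2⟩
  have hf : ContMDiffAt 𝓘(ℂ) 𝓘(ℂ) ω f (c : Y) := f.holomorphic c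
  have hw := f.contMDiffAt_coord_comp (c : Y)
  have hsrc := hf.continuousAt.eventually (eventually_mem_chart_source (f c))
  obtain ⟨m, hm, ⟨u, hu, -, huev⟩, h, hh, hhc, hhev⟩ :=
    exists_factorization_and_logDeriv hw (f.frequently_coord_ne_zero (c : Y))
  have hm' : m = multiplicity f (c : Y) := hm
  have key : ∀ k l, ∃ n : Y → ℂ, ContMDiffAt 𝓘(ℂ) 𝓘(ℂ) ω n (c : Y) ∧
      n c = (if twist S f c k = twist S f c l then
        (S.isLocalFrameOn (f c)).coeff k (f c) (B (f c) (S.frame (f c) l (f c))) else 0) ∧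
      ∀ᶠ p in 𝓝 (c : Y), n p * coord (c : Y) p ^ twist S f c l =
        coord (c : Y) p ^ twist S f c k *
          (S.isLocalFrameOn (f c)).coeff k (f p) (B (f p) (S.frame (f c) l (f p))) := by
    intro k l
    refine exists_holomorphic_twist hf hu huev (contMDiffAt_coeff_end S hB k l) ?_ ?_
    -- a smaller twist means a smaller weight, so the residue of `θ` has no such entry
    · intro hkl
      have hlt : P.weight ⟨f c, c.2⟩ (S.pos ⟨f c, c.2⟩ k) <
          P.weight ⟨f c, c.2⟩ (S.pos ⟨f c, c.2⟩ l) := by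
        by_contra! hle
        rw [twist_eq, twist_eq] at hkl
        exact absurd (Nat.floor_le_floor ((scaledWeight_le_iff c).2 hle)) (not_le.2 hkl)
      have := θ.coeff_res_eq_zero S ⟨f c, c.2⟩ hlt
      rw [← hBc] at this
      exact this
    · intro _
      rw [hm']
      exact twist_lt_multiplicity c l
  choose n hn hnc hnev using key
  refine ⟨fun p k l => h p * n k l p, ?_, ?_, ?_⟩
  · exact contMDiffAt_pi_space.2 fun k => contMDiffAt_pi_space.2 fun l => hh.mul (hn k l)
  · funext k l
    simp only [hhc, hnc, hm', HiggsField.pullbackResMatrix, ← hBc]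
  · have hnev' : ∀ᶠ p in 𝓝 (c : Y), ∀ k l, n k l p * coord (c : Y) p ^ twist S f c l =
        coord (c : Y) p ^ twist S f c k *
          (S.isLocalFrameOn (f c)).coeff k (f p) (B (f p) (S.frame (f c) l (f p))) :=
      eventually_all.2 fun k => eventually_all.2 fun l => hnev k l
    filter_upwards [hhev, hf.continuousAt.eventually hBev, hsrc, eventually_mem_chart_source (c : Y),
      eventually_differential_coord_comp f.holomorphic (c : Y), hnev',
      eventually_mem_pullbackBaseSet (S := S) (f := f) (c : Y)]
      with p h1 h2 h3 h4 h5 h6 h7 hp v e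
    have hz : coord (c : Y) p ≠ 0 := coord_ne_zero h4 fun hpc => hp (hpc ▸ c.2)
    have hw0 : coord (f c) (f p) ≠ 0 := coord_ne_zero h3 fun hpc => hp (by
      have := c.2
      rwa [mem_preimage, ← hpc] at this)
    have hT : θ.pullbackForm f ⟨p, hp⟩ v =
        (dcoord (c : Y) p v / coord (c : Y) p) • h p • B (f p) := by
      have h8 : dcoord (f c) (f p) (mfderiv 𝓘(ℂ) 𝓘(ℂ) f p v) / coord (f c) (f p) =
          dcoord (c : Y) p v / coord (c : Y) p * h p := by
        rw [← h5 v, div_eq_iff hw0]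
        have := h1 v
        field_simp
        linear_combination this
      rw [smul_smul, ← h8]
      exact h2 hp _
    rw [hT, _root_.smul_apply, map_smul, map_smul,
      pullback_continuousLinearMapAt_iso_map ⟨p, hp⟩ h7 (h p • B (f p))]
    intro k l
    simp only [_root_.smul_apply, map_smul, smul_eq_mul, mul_assoc, h6]
    ring

/-- A linear map between fibres of `f^*E_*` is determined, over `Y ∖ f⁻¹(D)`, by what it does to
`f^*E`. -/
theorem pullback_clm_ext {S : P.Splitting F} (y : ((f ⁻¹' D)ᶜ : Set Y))
    {A B : PullbackFiber S f y →L[ℂ] PullbackFiber S f y}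
    (h : ∀ e : E (f y), A (pullbackIso S f y e) = B (pullbackIso S f y e)) : A = B := by
  refine ContinuousLinearMap.ext fun v => ?_
  rw [← (pullbackIso S f y).apply_symm_apply v]
  exact h _

theorem endSection_pullback_self {S : P.Splitting F} (c : Y)
    (N : Y → (Fin (finrank ℂ F) → ℂ) →L[ℂ] (Fin (finrank ℂ F) → ℂ)) :
    endSection (PullbackFiber S f) c N c = N c := by
  refine ContinuousLinearMap.ext fun v => ?_
  have h := continuousLinearMapAt_endSection (V := PullbackFiber S f) (c := c)
    (mem_pullbackBaseSet_self c) N v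
  rw [pullback_continuousLinearMapAt_self, pullback_continuousLinearMapAt_self] at h
  exact h

theorem contMDiffAt_matCLM {r : ℕ} {c : Y} {N : Y → Fin r → Fin r → ℂ}
    (hN : ContMDiffAt 𝓘(ℂ) 𝓘(ℂ, Fin r → Fin r → ℂ) ω N c) :
    ContMDiffAt 𝓘(ℂ) 𝓘(ℂ, (Fin r → ℂ) →L[ℂ] (Fin r → ℂ)) ω (fun p => matCLM r (N p)) c :=
  (matCLM r).contMDiff.contMDiffAt.comp c hN

/-! ### Existence, the strong case and uniqueness -/

/-- The extension of `f^*θ` to a section of `End(f^*E_*) ⊗ K_Y(f⁻¹(D))`. -/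
def HiggsField.pullbackLog (θ : HiggsField F P) (S : P.Splitting F) (f : NonconstHolMap Y X) :
    LogHiggsField (Fin (finrank ℂ F) → ℂ) (PullbackFiber S f) (f ⁻¹' D) where
  form y := θ.pullbackEndForm S y
  res y := (matCLM (finrank ℂ F) (θ.pullbackResMatrix S y) :
    (Fin (finrank ℂ F) → ℂ) →L[ℂ] (Fin (finrank ℂ F) → ℂ))
  holomorphic_off c := by
    obtain ⟨N, hN, hev⟩ := θ.exists_pullback_matrix_off S c
    refine ⟨_, contMDiffAt_endSection (contMDiffAt_matCLM hN), ?_⟩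
    filter_upwards [hev, eventually_mem_pullbackBaseSet (S := S) (f := f) (c : Y)]
      with p h1 h2 hp v
    refine pullback_clm_ext ⟨p, hp⟩ fun e => pullback_continuousLinearMapAt_injective h2 ?_
    rw [LogHiggsField.pullbackEndForm_apply, h1 hp v e, _root_.smul_apply, map_smul,
      continuousLinearMapAt_endSection h2]
  holomorphic_at c := by
    obtain ⟨N, hN, hNc, hev⟩ := θ.exists_pullback_matrix_at S c
    refine ⟨_, contMDiffAt_endSection (contMDiffAt_matCLM hN), ?_, ?_⟩
    · rw [endSection_pullback_self, hNc]
    · filter_upwards [hev, eventually_mem_pullbackBaseSet (S := S) (f := f) (c : Y)]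
        with p h1 h2 hp v
      refine pullback_clm_ext ⟨p, hp⟩ fun e => pullback_continuousLinearMapAt_injective h2 ?_
      rw [LogHiggsField.pullbackEndForm_apply, h1 hp v e, _root_.smul_apply, map_smul,
        continuousLinearMapAt_endSection h2]

theorem scaledWeight_eq_fract_add_twist {S : P.Splitting F} (y : (f ⁻¹' D : Set Y))
    (k : Fin (finrank ℂ F)) :
    scaledWeight S f y k = Int.fract (scaledWeight S f y k) + twist S f y k := by
  rw [twist_eq, natCast_floor_eq_intCast_floor (scaledWeight_nonneg y k), Int.fract_add_floor]

theorem pullbackPos_le_iff {S : P.Splitting F} (y : (f ⁻¹' D : Set Y))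
    {k l : Fin (finrank ℂ F)} : pullbackPos S f y k ≤ pullbackPos S f y l ↔
      Int.fract (scaledWeight S f y k) ≤ Int.fract (scaledWeight S f y l) :=
  ((pullbackWeights S f y).orderIsoOfFin rfl).symm.le_iff_le

/-- For line bundles with the same twist at `y`, the parabolic weights of the pullback and those of
`E_*` are in the same order. -/
theorem pullbackPos_le_iff_weight_le {S : P.Splitting F} (y : (f ⁻¹' D : Set Y))
    {k l : Fin (finrank ℂ F)} (ht : twist S f y k = twist S f y l) :
    pullbackPos S f y k ≤ pullbackPos S f y l ↔
      P.weight ⟨f y, y.2⟩ (S.pos ⟨f y, y.2⟩ k) ≤ P.weight ⟨f y, y.2⟩ (S.pos ⟨f y, y.2⟩ l) := by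
  rw [← scaledWeight_le_iff, pullbackPos_le_iff, scaledWeight_eq_fract_add_twist y k,
    scaledWeight_eq_fract_add_twist y l, ht]
  simp

/-- The extension of `f^*θ` to a Higgs field on `f^*E_*`. -/
def HiggsField.pullback (θ : HiggsField F P) (S : P.Splitting F) (f : NonconstHolMap Y X) :
    HiggsField (Fin (finrank ℂ F) → ℂ) (parabolicPullback S f) where
  toLogHiggsField := θ.pullbackLog S f
  preserves y j v hv k hk := by
    change ∑ l, θ.pullbackResMatrix S y k l * (show Fin (finrank ℂ F) → ℂ from v) l = 0
    refine Finset.sum_eq_zero fun l _ => ?_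
    by_cases hl : (pullbackPos S f y l).castSucc < j
    · have h0 : (show Fin (finrank ℂ F) → ℂ from v) l = 0 := hv l hl
      rw [h0, mul_zero]
    · have hkl : pullbackPos S f y k < pullbackPos S f y l :=
        Fin.castSucc_lt_castSucc_iff.1 (lt_of_lt_of_le hk (not_lt.1 hl))
      rw [HiggsField.pullbackResMatrix]
      split_ifs with ht
      · rw [θ.coeff_res_eq_zero S ⟨f y, y.2⟩ (lt_iff_lt_of_le_iff_le
          (pullbackPos_le_iff_weight_le y ht.symm) |>.1 hkl), mul_zero, zero_mul]
      · rw [mul_zero, zero_mul]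

theorem HiggsField.extendsPullback_pullback (θ : HiggsField F P) (S : P.Splitting F)
    (f : NonconstHolMap Y X) : θ.ExtendsPullback (θ.pullback S f) :=
  fun y v e => θ.pullbackEndForm_apply y v e

theorem HiggsField.IsStrong.pullback {θ : HiggsField F P} (hθ : θ.IsStrong) (S : P.Splitting F)
    (f : NonconstHolMap Y X) : (θ.pullback S f).IsStrong := by
  intro y j v hv k hk
  change ∑ l, θ.pullbackResMatrix S y k l * (show Fin (finrank ℂ F) → ℂ from v) l = 0
  refine Finset.sum_eq_zero fun l _ => ?_
  by_cases hl : (pullbackPos S f y l).castSucc < j.castSucc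
  · have h0 : (show Fin (finrank ℂ F) → ℂ from v) l = 0 := hv l hl
    rw [h0, mul_zero]
  · have hkl : pullbackPos S f y k ≤ pullbackPos S f y l :=
      (Fin.castSucc_lt_succ_iff.1 hk).trans (Fin.castSucc_le_castSucc_iff.1 (not_lt.1 hl))
    rw [HiggsField.pullbackResMatrix]
    split_ifs with ht
    · rw [hθ.coeff_res_eq_zero S ⟨f y, y.2⟩ ((pullbackPos_le_iff_weight_le y ht).1 hkl),
        mul_zero, zero_mul]
    · rw [mul_zero, zero_mul]

/-- A section of `End(V) ⊗ K_Y(D)` is determined by its restriction to the complement of `D`. -/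
theorem LogHiggsField.eq_of_form_eq {F' : Type*} [NormedAddCommGroup F'] [NormedSpace ℂ F']
    {V : Y → Type*} [∀ x, AddCommGroup (V x)] [∀ x, Module ℂ (V x)]
    [TopologicalSpace (TotalSpace F' V)] [∀ x, TopologicalSpace (V x)] [FiberBundle F' V]
    [VectorBundle ℂ F' V] [∀ x, IsTopologicalAddGroup (V x)] [∀ x, ContinuousSMul ℂ (V x)]
    {D' : Set Y} (hD : D'.Finite) {θ₁ θ₂ : LogHiggsField F' V D'} (h : θ₁.form = θ₂.form) :
    θ₁ = θ₂ := by
  refine LogHiggsField.ext h (funext fun c => ?_)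
  obtain ⟨B₁, hB₁, hc₁, hev₁⟩ := θ₁.holomorphic_at c
  obtain ⟨B₂, hB₂, hc₂, hev₂⟩ := θ₂.holomorphic_at c
  rw [← hc₁, ← hc₂]
  refine endSection_unique hB₁ hB₂ ?_
  have hDc : ∀ᶠ p in 𝓝[≠] (c : Y), p ∉ D' := by
    rw [eventually_nhdsWithin_iff]
    filter_upwards [(hD.subset (sdiff_subset (t := {(c : Y)}))).isClosed.isOpen_compl.mem_nhds
      (fun hc => hc.2 rfl)] with p hp hpc hpD
    exact hp ⟨hpD, hpc⟩
  filter_upwards [hDc, self_mem_nhdsWithin, nhdsWithin_le_nhds hev₁, nhdsWithin_le_nhds hev₂,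
    nhdsWithin_le_nhds (eventually_mem_chart_source (c : Y))] with p hp hpc h1 h2 hps
  obtain ⟨v, hv⟩ := exists_dcoord_ne_zero hps
  have h3 := (h1 hp v).symm.trans ((congrArg (fun A => A ⟨p, hp⟩ v) h).trans (h2 hp v))
  exact smul_right_injective _ (div_ne_zero hv (coord_ne_zero hps hpc)) h3

theorem HiggsField.ExtendsPullback.unique {θ : HiggsField F P} {S : P.Splitting F}
    {θ₁ θ₂ : HiggsField (Fin (finrank ℂ F) → ℂ) (parabolicPullback S f)}
    (h₁ : θ.ExtendsPullback θ₁) (h₂ : θ.ExtendsPullback θ₂) : θ₁ = θ₂ := by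
  have h : θ₁.toLogHiggsField = θ₂.toLogHiggsField := by
    refine LogHiggsField.eq_of_form_eq (f.finite_preimage P.finite_divisor) (funext fun y => ?_)
    refine ContinuousLinearMap.ext fun v => pullback_clm_ext y fun e => ?_
    rw [h₁ y v e, h₂ y v e]
  exact HiggsField.ext (congrArg LogHiggsField.form h) (congrArg LogHiggsField.res h)

end Pullback

end ParHiggs

end

open ParHiggs in
theorem proposition5p1 {X Y : Type*}
    [TopologicalSpace X] [ChartedSpace ℂ X] [IsManifold 𝓘(ℂ) ω X]
    [T2Space X] [CompactSpace X] [ConnectedSpace X]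
    [TopologicalSpace Y] [ChartedSpace ℂ Y] [IsManifold 𝓘(ℂ) ω Y]
    [T2Space Y] [CompactSpace Y] [ConnectedSpace Y]
    {F : Type*} [NormedAddCommGroup F] [NormedSpace ℂ F] [FiniteDimensional ℂ F]
    {E : X → Type*} [∀ x, AddCommGroup (E x)] [∀ x, Module ℂ (E x)]
    [TopologicalSpace (TotalSpace F E)] [∀ x, TopologicalSpace (E x)]
    [∀ x, IsTopologicalAddGroup (E x)] [∀ x, ContinuousSMul ℂ (E x)]
    [FiberBundle F E] [VectorBundle ℂ F E] [ContMDiffVectorBundle ω F E 𝓘(ℂ)]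
    {D : Set X} (P : ParabolicStructure E D) (S : P.Splitting F)
    (f : NonconstHolMap Y X) (θ : HiggsField F P) :
    (∃! θ' : HiggsField (Fin (Module.finrank ℂ F) → ℂ) (parabolicPullback S f),
      θ.ExtendsPullback θ') ∧
    (θ.IsStrong → ∀ θ' : HiggsField (Fin (Module.finrank ℂ F) → ℂ) (parabolicPullback S f),
      θ.ExtendsPullback θ' → θ'.IsStrong) := by
  refine ⟨⟨θ.pullback S f, θ.extendsPullback_pullback S f, fun _ h =>
    h.unique (θ.extendsPullback_pullback S f)⟩, fun hθ θ' h => ?_⟩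
  rw [h.unique (θ.extendsPullback_pullback S f)]
  exact hθ.pullback S f
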